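/- **Setting.** Fix a core radius $a>0$, a spacing $D_h>a$, a background index $n_0>0$, an index contrast $\Delta n>0$ and a wavelength $\lambda>0$; put $k=2\pi n_0/\lambda$. For $0<\beta_0<k\Delta n/n_0$ let $$\Lambda=\sqrt{\tfrac{2k^2\Delta n}{n_0}-2k\beta_0}>0,\qquad \Gamma=\sqrt{2k\beta_0}>0 ,$$ and assume that $\beta_0$ is the longitudinal wavenumber shift of a rotationally symmetric guided mode of a single waveguide (for instance the fundamental one), i.e. $J_0(\Lambda a)\neq0$ and $$\frac{\Lambda J_1(\Lambda a)}{J_0(\Lambda a)}=\frac{\Gamma K_1(\Gamma a)}{K_0(\Gamma a)} .$$ Here $J_n$ are the Bessel functions of the first kind and $I_n,K_n$ the modified Bessel functions of the first and second kind. Let $$A=\Big[\pi a^2\big(J_1^2(\Lambda a)+J_0^2(\Lambda a)\big)+\pi a^2\Big(\frac{J_0(\Lambda a)}{K_0(\Gamma a)}\Big)^2\big(K_1^2(\Gamma a)-K_0^2(\Gamma a)\big)\Big]^{-1/2},\qquad B=A\,\frac{J_0(\Lambda a)}{K_0(\Gamma a)},$$ let $\phi(r)=AJ_0(\Lambda r)$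 for $0\le r<a$ and $\phi(r)=BK_0(\Gamma r)$ for $r\ge a$, and for $m\in\mathbb Z$ let $\phi_m(x,y)=\phi\big(\sqrt{(x-mD_h)^2+y^2}\big)$ be the mode of the waveguide centred at $(mD_h,0)$. The overlap integrals are $$S_{ij}=\iint_{\mathbb R^2}\phi_i(x,y)\,\phi_j(x,y)\,dx\,dy,\qquad i,j\in\mathbb Z .$$ **Theorem.** For all $i,j\in\mathbb Z$ the product $\phi_i\phi_j$ is integrable on $\mathbb R^2$. Moreover $S_{ii}=1$ for every $i$. If $|i-j|=\xi\geq 1$ and $d=\xi D_h$ satisfies $d\ge 2a$ (the two cores do not overlap), then $S_{ij}=S_\xi$, where $$\begin{aligned}S_\xi={}&\frac{4a\pi AB\,K_0(\Gamma d)}{\Gamma^2+\Lambda^2}\big[\Lambda I_0(\Gamma a)J_1(\Lambda a)+\Gamma J_0(\Lambda a)I_1(\Gamma a)\big]+\frac{\pi B^2 d\,K_1(\Gamma d)}{\Gamma}\\&-2\pi B^2a^2K_0(\Gamma d)\big[I_0(\Gamma a)K_0(\Gamma a)+I_1(\Gamma a)K_1(\Gamma a)\big].\end{aligned}$$ -/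

import Mathlib

open MeasureTheory

noncomputable section

/-- Bessel function of the first kind `J_n` of integer order `n ≥ 0`. -/
def besselJ (n : ℕ) (x : ℝ) : ℝ :=
  ∑' m : ℕ, (-1 : ℝ) ^ m / ((m.factorial : ℝ) * ((m + n).factorial : ℝ)) * (x / 2) ^ (2 * m + n)

/-- Modified Bessel function of the first kind `I_n` of integer order `n ≥ 0`. -/
def besselI (n : ℕ) (x : ℝ) : ℝ :=
  ∑' m : ℕ, 1 / ((m.factorial : ℝ) * ((m + n).factorial : ℝ)) * (x / 2) ^ (2 * m + n)

/-- Modified Bessel function of the second kind `K_n`, for arguments `x > 0`, through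
`K_n(x) = ∫₀^∞ exp (-x cosh t) cosh (n t) dt`. -/
def besselK (n : ℕ) (x : ℝ) : ℝ :=
  ∫ t in Set.Ioi (0 : ℝ), Real.exp (-x * Real.cosh t) * Real.cosh ((n : ℝ) * t)

/-- Horizontal array of identical step-index circular waveguides with centres `(m * Dh, 0)`. -/
structure WaveguideArray where
  /-- core radius -/
  a : ℝ
  /-- centre-to-centre spacing -/
  Dh : ℝ
  /-- background refractive index -/
  n₀ : ℝ
  /-- index contrast of the core -/
  Δn : ℝ
  /-- vacuum wavelength -/
  wavelength : ℝ
  a_pos : 0 < a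
  a_lt_Dh : a < Dh
  n₀_pos : 0 < n₀
  Δn_pos : 0 < Δn
  wavelength_pos : 0 < wavelength

namespace WaveguideArray

/-- Background wavenumber `k = 2π n₀ / λ`. -/
def k (W : WaveguideArray) : ℝ := 2 * Real.pi / W.wavelength * W.n₀

/-- `Λ = √(2 k² Δn / n₀ - 2 k β₀)`. -/
def coreΛ (W : WaveguideArray) (β₀ : ℝ) : ℝ :=
  Real.sqrt (2 * W.k ^ 2 * W.Δn / W.n₀ - 2 * W.k * β₀)

/-- `Γ = √(2 k β₀)`. -/
def cladΓ (W : WaveguideArray) (β₀ : ℝ) : ℝ := Real.sqrt (2 * W.k * β₀)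

/-- `β₀` is the longitudinal wavenumber shift of a guided rotationally symmetric mode of a single
waveguide: it lies in the guided range (so that `Λ` and `Γ` are positive) and satisfies the
characteristic equation. The fundamental mode is the one for which moreover `J₀` has no zero on
`[0, Λ a]`; this is not demanded here. -/
structure IsGuidedShift (W : WaveguideArray) (β₀ : ℝ) : Prop where
  pos : 0 < β₀
  lt : β₀ < W.k * W.Δn / W.n₀
  J_ne_zero : besselJ 0 (W.coreΛ β₀ * W.a) ≠ 0
  characteristic :
    W.coreΛ β₀ * besselJ 1 (W.coreΛ β₀ * W.a) / besselJ 0 (W.coreΛ β₀ * W.a) =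
      W.cladΓ β₀ * besselK 1 (W.cladΓ β₀ * W.a) / besselK 0 (W.cladΓ β₀ * W.a)

/-- Amplitude in the core. -/
def ampA (W : WaveguideArray) (β₀ : ℝ) : ℝ :=
  (Real.pi * W.a ^ 2 *
      (besselJ 1 (W.coreΛ β₀ * W.a) ^ 2 + besselJ 0 (W.coreΛ β₀ * W.a) ^ 2) +
    Real.pi * W.a ^ 2 * (besselJ 0 (W.coreΛ β₀ * W.a) / besselK 0 (W.cladΓ β₀ * W.a)) ^ 2 *
      (besselK 1 (W.cladΓ β₀ * W.a) ^ 2 - besselK 0 (W.cladΓ β₀ * W.a) ^ 2)) ^ (-(1 / 2) : ℝ)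

/-- Amplitude in the cladding. -/
def ampB (W : WaveguideArray) (β₀ : ℝ) : ℝ :=
  W.ampA β₀ * (besselJ 0 (W.coreΛ β₀ * W.a) / besselK 0 (W.cladΓ β₀ * W.a))

/-- Radial profile: `A J₀(Λ r)` in the core, `B K₀(Γ r)` outside (both agree at `r = a`). -/
def profile (W : WaveguideArray) (β₀ : ℝ) (r : ℝ) : ℝ :=
  if r < W.a then W.ampA β₀ * besselJ 0 (W.coreΛ β₀ * r)
  else W.ampB β₀ * besselK 0 (W.cladΓ β₀ * r)

/-- Mode `φ_m(x, y)` of the waveguide with centre `(m * Dh, 0)`. -/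
def mode (W : WaveguideArray) (β₀ : ℝ) (m : ℤ) (p : ℝ × ℝ) : ℝ :=
  W.profile β₀ (Real.sqrt ((p.1 - m * W.Dh) ^ 2 + p.2 ^ 2))

/-- Overlap integral `S_{ij} = ∬ φ_i φ_j dx dy` over the plane. -/
def overlap (W : WaveguideArray) (β₀ : ℝ) (i j : ℤ) : ℝ :=
  ∫ p : ℝ × ℝ, W.mode β₀ i p * W.mode β₀ j p

end WaveguideArray

end

open MeasureTheory Filter Topology

/-! Write each mode as `B K₀(Γ r)` plus an excess that vanishes outside its core (`coreExcess`).
When `d ≥ 2a` the cores are disjoint, so the product of two excesses is zero. The overlap is then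
`B²` times the self-convolution of `K₀` at distance `d`, plus two cross terms of excess against
`K₀`, which are equal by reflection.

Both kinds of term reduce to one-dimensional integrals by the circular mean of `K₀`: over the circle
of radius `r` about a point at distance `d` from the singularity, the mean is `I₀(Γ min) K₀(Γ max)`,
with `min` and `max` taken over `r, d` (`integral_besselK_circle`). To prove this, the contour in `∫
exp(-x cosh t) dt` is shifted by an imaginary amount, so that `K₀` of a distance becomes an integral
of exponentials linear in the coordinates. After Fubini the angular integral depends only on the
product of two coefficients, so it gives `I₀` and no longer involves `t`.

The radial integrals have explicit primitives supplied by the Bessel equations in first-order form,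
`J₀' = -J₁`, `(x J₁)' = x J₀` and their analogues for `I` and `K`. For the `K₀`-`K₀` term the
contributions inside and outside radius `d` collapse through the Wronskian of `I₀` and `K₀`. The
norm of a mode comes from the same primitives, and integrability of the products from square
integrability of the modes. -/

/-! ### Power series: derivatives of `J` and `I`. -/

theorem summable_pow_div_factorial_of_bounded {e : ℕ → ℝ} (he : ∀ m, |e m| ≤ 1) (t : ℝ) :
    Summable fun m : ℕ => e m * t ^ m / (m.factorial : ℝ) := by
  refine Summable.of_norm_bounded (Real.summable_pow_div_factorial |t|) fun m => ?_
  rw [norm_div, norm_mul, norm_pow, Real.norm_eq_abs, Real.norm_eq_abs, Real.norm_natCast]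
  gcongr
  exact mul_le_of_le_one_left (by positivity) (he m)

/-- Exponential generating functions of bounded sequences are differentiated by shifting. -/
theorem hasDerivAt_tsum_pow_div_factorial {e : ℕ → ℝ} (he : ∀ m, |e m| ≤ 1) (t : ℝ) :
    HasDerivAt (fun t : ℝ => ∑' m : ℕ, e m * t ^ m / (m.factorial : ℝ))
      (∑' m : ℕ, e (m + 1) * t ^ m / (m.factorial : ℝ)) t := by
  set R : ℝ := |t| + 1
  have hR : 0 < R := by positivity
  have hs : Summable fun m : ℕ => (m : ℝ) * R ^ (m - 1) / (m.factorial : ℝ) := by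
    rw [← summable_nat_add_iff 1]
    refine (Real.summable_pow_div_factorial R).congr fun m => ?_
    rw [Nat.factorial_succ]
    push_cast
    field_simp
  have key := hasDerivAt_tsum_of_isPreconnected (t := Metric.ball (0 : ℝ) R)
    (g := fun (m : ℕ) (t : ℝ) => e m * t ^ m / (m.factorial : ℝ))
    (g' := fun (m : ℕ) (t : ℝ) => e m * ((m : ℝ) * t ^ (m - 1)) / (m.factorial : ℝ))
    hs Metric.isOpen_ball
    (convex_ball _ _).isPreconnected
    (fun m y _ => ((hasDerivAt_pow m y).const_mul _).div_const _)
    (fun m y hy => by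
      rw [mem_ball_zero_iff, Real.norm_eq_abs] at hy
      rw [norm_div, norm_mul, norm_mul, norm_pow, Real.norm_eq_abs, Real.norm_eq_abs,
        Nat.abs_cast, Real.norm_natCast, Real.norm_eq_abs]
      refine div_le_div_of_nonneg_right ?_ (by positivity)
      refine (mul_le_of_le_one_left (by positivity) (he m)).trans ?_
      gcongr)
    (y₀ := 0) (by simpa using hR) (summable_pow_div_factorial_of_bounded he 0)
    (y := t) (by simp [R])
  refine key.congr_deriv ?_
  rw [Summable.tsum_eq_zero_add]
  · simp only [Nat.cast_zero, zero_mul, mul_zero, zero_div, zero_add]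
    refine tsum_congr fun m => ?_
    rw [Nat.factorial_succ]
    push_cast
    field_simp
  · refine Summable.of_norm_bounded hs fun m => ?_
    rw [norm_div, norm_mul, norm_mul, norm_pow, Real.norm_eq_abs, Real.norm_eq_abs,
        Nat.abs_cast, Real.norm_natCast, Real.norm_eq_abs]
    refine div_le_div_of_nonneg_right ?_ (by positivity)
    refine (mul_le_of_le_one_left (by positivity) (he m)).trans ?_
    gcongr
    simp [R]

noncomputable section

/-- The power series common to `J_n` (`ε = -1`) and `I_n` (`ε = 1`). -/
def besselSeries (ε : ℝ) (n : ℕ) (x : ℝ) : ℝ :=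
  ∑' m : ℕ, ε ^ m / ((m.factorial : ℝ) * ((m + n).factorial : ℝ)) * (x / 2) ^ (2 * m + n)

end

theorem besselJ_eq_series (n : ℕ) : besselJ n = besselSeries (-1) n := rfl

theorem besselI_eq_series (n : ℕ) : besselI n = besselSeries 1 n := by
  ext x
  simp [besselI, besselSeries]

theorem abs_pow_div_factorial_le_one {ε : ℝ} (hε : |ε| = 1) (m : ℕ) :
    |ε ^ m / (m.factorial : ℝ)| ≤ 1 := by
  rw [abs_div, abs_pow, hε, one_pow, Nat.abs_cast]
  exact div_le_one_of_le₀ (by exact_mod_cast m.factorial_pos) (by positivity)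

theorem hasDerivAt_besselSeries_zero {ε : ℝ} (hε : |ε| = 1) (x : ℝ) :
    HasDerivAt (besselSeries ε 0) (ε * besselSeries ε 1 x) x := by
  have h1 := (hasDerivAt_tsum_pow_div_factorial (abs_pow_div_factorial_le_one hε)
    ((x / 2) ^ 2)).comp x (((hasDerivAt_id x).div_const 2).pow 2)
  have h2 : besselSeries ε 0 = (fun t : ℝ => ∑' m : ℕ, ε ^ m / (m.factorial : ℝ) * t ^ m /
      (m.factorial : ℝ)) ∘ (fun x => (x / 2) ^ 2) := by
    ext x
    refine tsum_congr fun m => ?_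
    rw [← pow_mul]
    simp only [add_zero]
    field_simp
  rw [h2]
  refine h1.congr_deriv ?_
  unfold besselSeries
  rw [← tsum_mul_left, ← tsum_mul_right]
  refine tsum_congr fun m => ?_
  simp only [id, Nat.cast_ofNat, ← pow_mul]
  field_simp
  ring_nf

theorem hasDerivAt_mul_besselSeries_one {ε : ℝ} (hε : |ε| = 1) (x : ℝ) :
    HasDerivAt (fun x => x * besselSeries ε 1 x) (x * besselSeries ε 0 x) x := by
  -- In the variable `s = (x/2)²` the function is `2 ∑ e m sᵐ / m!`; the coefficient `e 0 = 0`
  -- accounts for the extra factor `s`, and differentiation shifts it away, leaving the series of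
  -- order zero.
  set e : ℕ → ℝ := fun m => Nat.casesOn m 0 fun k => ε ^ k / (k.factorial : ℝ) with he
  have hb : ∀ m, |e m| ≤ 1 := by
    rintro (_ | m)
    · simp [he]
    · exact abs_pow_div_factorial_le_one hε m
  have h1 := ((hasDerivAt_tsum_pow_div_factorial hb
    ((x / 2) ^ 2)).comp x (((hasDerivAt_id x).div_const 2).pow 2)).const_mul 2
  have h2 : (fun x => x * besselSeries ε 1 x) = fun x => 2 * ((fun t : ℝ => ∑' m : ℕ,
      e m * t ^ m / (m.factorial : ℝ)) ∘ (fun x => (x / 2) ^ 2)) x := by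
    ext x
    rw [Function.comp_apply, (summable_pow_div_factorial_of_bounded hb _).tsum_eq_zero_add,
      besselSeries, ← tsum_mul_left]
    have h0 : e 0 = 0 := rfl
    rw [h0, zero_mul, zero_div, zero_add, ← tsum_mul_left]
    refine tsum_congr fun m => ?_
    have h1' : e (m + 1) = ε ^ m / (m.factorial : ℝ) := rfl
    rw [← pow_mul, h1']
    field_simp
    ring
  rw [h2]
  refine h1.congr_deriv ?_
  unfold besselSeries
  rw [← tsum_mul_left, ← tsum_mul_right, ← tsum_mul_left]
  refine tsum_congr fun m => ?_
  have h1' : e (m + 1) = ε ^ m / (m.factorial : ℝ) := rfl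
  simp only [id, Nat.cast_ofNat, h1', ← pow_mul]
  field_simp
  ring_nf

theorem hasDerivAt_besselJ_zero (x : ℝ) : HasDerivAt (besselJ 0) (-besselJ 1 x) x := by
  rw [besselJ_eq_series, besselJ_eq_series]
  convert hasDerivAt_besselSeries_zero (ε := -1) (by simp) x using 1
  ring

theorem hasDerivAt_mul_besselJ_one (x : ℝ) :
    HasDerivAt (fun x => x * besselJ 1 x) (x * besselJ 0 x) x := by
  rw [besselJ_eq_series, besselJ_eq_series]
  exact hasDerivAt_mul_besselSeries_one (by simp) x

theorem hasDerivAt_besselI_zero (x : ℝ) : HasDerivAt (besselI 0) (besselI 1 x) x := by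
  rw [besselI_eq_series, besselI_eq_series]
  convert hasDerivAt_besselSeries_zero (ε := 1) (by simp) x using 1
  ring

theorem hasDerivAt_mul_besselI_one (x : ℝ) :
    HasDerivAt (fun x => x * besselI 1 x) (x * besselI 0 x) x := by
  rw [besselI_eq_series, besselI_eq_series]
  exact hasDerivAt_mul_besselSeries_one (by simp) x

theorem continuous_besselJ_zero : Continuous (besselJ 0) :=
  continuous_iff_continuousAt.2 fun x => (hasDerivAt_besselJ_zero x).continuousAt

theorem continuous_besselI_zero : Continuous (besselI 0) :=
  continuous_iff_continuousAt.2 fun x => (hasDerivAt_besselI_zero x).continuousAt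

theorem besselI_zero_nonneg (x : ℝ) : 0 ≤ besselI 0 x :=
  tsum_nonneg fun m => by
    have : (0 : ℝ) ≤ (x / 2) ^ (2 * m + 0) := by rw [add_zero, pow_mul]; positivity
    positivity

/-- `I₀(2√s) = ∑ sᵐ / (m!)²`, written for `s = (x / 2)²`. -/
theorem hasSum_besselI_zero (x : ℝ) :
    HasSum (fun m : ℕ => ((x / 2) ^ 2) ^ m / ((m.factorial : ℝ) * (m.factorial : ℝ)))
      (besselI 0 x) := by
  have h := summable_pow_div_factorial_of_bounded
    (abs_pow_div_factorial_le_one (ε := 1) (by simp)) ((x / 2) ^ 2)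
  have h2 : besselI 0 x =
      ∑' m : ℕ, 1 ^ m / (m.factorial : ℝ) * ((x / 2) ^ 2) ^ m / (m.factorial : ℝ) := by
    refine tsum_congr fun m => ?_
    rw [← pow_mul]
    simp only [add_zero, one_pow]
    field_simp
  rw [h2]
  convert h.hasSum using 2 with m
  simp only [one_pow]
  field_simp

/-! ### Integral representation: derivatives of `K`. -/

theorem one_add_sq_div_two_le_cosh (t : ℝ) : 1 + t ^ 2 / 2 ≤ Real.cosh t := by
  have h1 : Real.cosh t = 1 + 2 * Real.sinh (t / 2) ^ 2 := by
    have h := Real.cosh_two_mul (t / 2)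
    rw [Real.cosh_sq, mul_div_cancel₀ t two_ne_zero] at h
    linarith
  have h2 : (t / 2) ^ 2 ≤ Real.sinh (t / 2) ^ 2 := by
    rw [sq_le_sq, Real.abs_sinh]
    exact Real.self_le_sinh_iff.2 (abs_nonneg _)
  rw [h1]
  linarith

/-- Half of the exponent absorbs the power of `cosh`, since `yʲ / j! ≤ exp y` at `y = (c/2) cosh t`.
The other half is dominated by a Gaussian, since `cosh t ≥ t²/2`. -/
theorem integrable_cosh_pow_mul_exp (j : ℕ) {c : ℝ} (hc : 0 < c) :
    Integrable fun t : ℝ => Real.cosh t ^ j * Real.exp (-c * Real.cosh t) := by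
  have hg := (integrable_exp_neg_mul_sq (b := c / 4) (by positivity)).const_mul
    ((j.factorial : ℝ) * (2 / c) ^ j)
  refine hg.mono' (by fun_prop) (Eventually.of_forall fun t => ?_)
  have hcosh := Real.cosh_pos t
  rw [Real.norm_of_nonneg (by positivity)]
  have h1 : Real.cosh t ^ j ≤ (j.factorial : ℝ) * (2 / c) ^ j *
      Real.exp (c / 2 * Real.cosh t) := by
    have h := Real.pow_div_factorial_le_exp (x := c / 2 * Real.cosh t) (by positivity) j
    rw [div_le_iff₀ (by positivity), mul_pow] at h
    calc Real.cosh t ^ j = (2 / c) ^ j * ((c / 2) ^ j * Real.cosh t ^ j) := by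
          rw [← mul_assoc, ← mul_pow]
          field_simp
          simp
      _ ≤ (2 / c) ^ j * (Real.exp (c / 2 * Real.cosh t) * (j.factorial : ℝ)) := by gcongr
      _ = _ := by ring
  calc _ ≤ (j.factorial : ℝ) * (2 / c) ^ j * Real.exp (c / 2 * Real.cosh t) *
        Real.exp (-c * Real.cosh t) := by gcongr
    _ = (j.factorial : ℝ) * (2 / c) ^ j * Real.exp (-(c / 2) * Real.cosh t) := by
        rw [mul_assoc _ (Real.exp _), ← Real.exp_add]
        ring_nf
    _ ≤ _ := by
        refine mul_le_mul_of_nonneg_left (Real.exp_le_exp.2 ?_) (by positivity)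
        nlinarith [one_add_sq_div_two_le_cosh t]

theorem integrable_exp_neg_mul_cosh {c : ℝ} (hc : 0 < c) :
    Integrable fun t : ℝ => Real.exp (-c * Real.cosh t) := by
  simpa using integrable_cosh_pow_mul_exp 0 hc

noncomputable section

/-- `∫₀^∞ (cosh t)ʲ exp (-x cosh t) dt`. -/
def coshMoment (j : ℕ) (x : ℝ) : ℝ :=
  ∫ t in Set.Ioi (0 : ℝ), Real.cosh t ^ j * Real.exp (-x * Real.cosh t)

end

theorem besselK_zero_eq_coshMoment : besselK 0 = coshMoment 0 := by
  ext x
  simp [besselK, coshMoment]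

theorem besselK_one_eq_coshMoment : besselK 1 = coshMoment 1 := by
  ext x
  simp [besselK, coshMoment, mul_comm]

theorem hasDerivAt_coshMoment (j : ℕ) {x : ℝ} (hx : 0 < x) :
    HasDerivAt (coshMoment j) (-coshMoment (j + 1) x) x := by
  have h := hasDerivAt_integral_of_dominated_loc_of_deriv_le (𝕜 := ℝ)
    (μ := volume.restrict (Set.Ioi (0 : ℝ))) (s := Set.Ioi (x / 2)) (x₀ := x)
    (F := fun x t => Real.cosh t ^ j * Real.exp (-x * Real.cosh t))
    (F' := fun x t => -(Real.cosh t ^ (j + 1) * Real.exp (-x * Real.cosh t)))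
    (bound := fun t => Real.cosh t ^ (j + 1) * Real.exp (-(x / 2) * Real.cosh t))
    (Ioi_mem_nhds (by linarith)) (Eventually.of_forall fun y => by fun_prop)
    (integrable_cosh_pow_mul_exp j hx).integrableOn (by fun_prop)
    (Eventually.of_forall fun t y hy => by
      have := Real.cosh_pos t
      rw [norm_neg, Real.norm_of_nonneg (by positivity)]
      rw [Set.mem_Ioi] at hy
      gcongr)
    (integrable_cosh_pow_mul_exp (j + 1) (by positivity)).integrableOn
    (Eventually.of_forall fun t y _ => by
      refine (((((hasDerivAt_id y).neg).mul_const (Real.cosh t)).exp).const_mul _).congr_deriv ?_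
      simp only [Pi.neg_apply, id]
      ring)
  have h2 := h.2
  rw [integral_neg] at h2
  exact h2

/-- Integration by parts: the total derivative of `sinh t · exp(-x cosh t)` integrates to zero. This
is the Bessel equation for `K₀` in disguise and yields `(x K₁)' = -x K₀`. -/
theorem coshMoment_two {x : ℝ} (hx : 0 < x) :
    coshMoment 2 x = coshMoment 0 x + coshMoment 1 x / x := by
  have hd : ∀ t : ℝ, HasDerivAt (fun t => Real.sinh t * Real.exp (-x * Real.cosh t))
      (Real.cosh t ^ 1 * Real.exp (-x * Real.cosh t) -
        x * (Real.cosh t ^ 2 * Real.exp (-x * Real.cosh t)) +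
        x * (Real.cosh t ^ 0 * Real.exp (-x * Real.cosh t))) t := fun t => by
    refine ((Real.hasDerivAt_sinh t).mul
      (((Real.hasDerivAt_cosh t).const_mul (-x)).exp)).congr_deriv ?_
    rw [Real.cosh_sq]
    ring
  have hi := fun j => (integrable_cosh_pow_mul_exp j hx).integrableOn (s := Set.Ioi 0)
  have hi' := ((hi 1).sub ((hi 2).const_mul x)).add ((hi 0).const_mul x)
  have hf : IntegrableOn (fun t => Real.sinh t * Real.exp (-x * Real.cosh t)) (Set.Ioi 0) := by
    refine (hi 1).mono' (by fun_prop) (Eventually.of_forall fun t => ?_)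
    rw [norm_mul, Real.norm_of_nonneg (Real.exp_pos _).le, Real.norm_eq_abs, Real.abs_sinh, pow_one,
      ← Real.cosh_abs]
    gcongr
    exact (Real.sinh_lt_cosh _).le
  have ht := tendsto_zero_of_hasDerivAt_of_integrableOn_Ioi (a := 0) (fun t _ => hd t) hi' hf
  have h := integral_Ioi_of_hasDerivAt_of_tendsto' (a := 0) (fun t _ => hd t) hi' ht
  have h := (integral_add ((hi 1).sub ((hi 2).const_mul x)) ((hi 0).const_mul x)).symm.trans h
  rw [integral_sub' (hi 1) ((hi 2).const_mul x), integral_const_mul, integral_const_mul] at h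
  simp only [Real.sinh_zero, zero_mul, sub_zero] at h
  change coshMoment 1 x - x * coshMoment 2 x + x * coshMoment 0 x = 0 at h
  field_simp
  linarith

theorem hasDerivAt_besselK_zero {x : ℝ} (hx : 0 < x) :
    HasDerivAt (besselK 0) (-besselK 1 x) x := by
  rw [besselK_zero_eq_coshMoment, besselK_one_eq_coshMoment]
  exact hasDerivAt_coshMoment 0 hx

theorem hasDerivAt_mul_besselK_one {x : ℝ} (hx : 0 < x) :
    HasDerivAt (fun x => x * besselK 1 x) (-(x * besselK 0 x)) x := by
  rw [besselK_zero_eq_coshMoment, besselK_one_eq_coshMoment]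
  refine ((hasDerivAt_id x).mul (hasDerivAt_coshMoment 1 hx)).congr_deriv ?_
  rw [coshMoment_two hx]
  simp only [id]
  field_simp
  ring

theorem besselK_zero_nonneg (x : ℝ) : 0 ≤ besselK 0 x := by
  rw [besselK_zero_eq_coshMoment]
  exact integral_nonneg fun t => mul_nonneg (pow_nonneg (Real.cosh_pos t).le _) (Real.exp_pos _).le

theorem besselK_zero_le_one {x : ℝ} (hx : 0 < x) : besselK 0 x ≤ besselK 1 x := by
  rw [besselK_zero_eq_coshMoment, besselK_one_eq_coshMoment]
  refine integral_mono (integrable_cosh_pow_mul_exp 0 hx).integrableOn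
    (integrable_cosh_pow_mul_exp 1 hx).integrableOn fun t => ?_
  have := Real.one_le_cosh t
  simp only [pow_zero, pow_one]
  gcongr

/-! ### Behaviour of `K₀` and `K₁` at zero and infinity. -/

/-- An exactly integrable majorant of the integrand of `x K₁(x)`, obtained by replacing `cosh` with
`sinh` in the exponent. It gives upper and lower bounds for `x K₁(x)`. -/
theorem integral_cosh_mul_exp_neg_sinh {x : ℝ} (hx : 0 < x) :
    IntegrableOn (fun t => x * Real.cosh t * Real.exp (-x * Real.sinh t)) (Set.Ioi 0) ∧
      ∫ t in Set.Ioi (0 : ℝ), x * Real.cosh t * Real.exp (-x * Real.sinh t) = 1 := by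
  have hd : ∀ t ∈ Set.Ici (0 : ℝ), HasDerivAt (fun t => -Real.exp (-x * Real.sinh t))
      (x * Real.cosh t * Real.exp (-x * Real.sinh t)) t := fun t _ => by
    refine (((Real.hasDerivAt_sinh t).const_mul (-x)).exp.neg).congr_deriv ?_
    ring
  have hpos : ∀ t ∈ Set.Ioi (0 : ℝ), 0 ≤ x * Real.cosh t * Real.exp (-x * Real.sinh t) :=
    fun t _ => by have := Real.cosh_pos t; positivity
  have hs : Tendsto Real.sinh atTop atTop := Real.sinhOrderIso.tendsto_atTop
  have ht : Tendsto (fun t => -Real.exp (-x * Real.sinh t)) atTop (𝓝 0) := by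
    rw [← neg_zero]
    refine (Real.tendsto_exp_atBot.comp ?_).neg
    exact hs.const_mul_atTop_of_neg (by linarith)
  refine ⟨integrableOn_Ioi_deriv_of_nonneg' hd hpos ht, ?_⟩
  rw [integral_Ioi_of_hasDerivAt_of_nonneg' hd hpos ht]
  simp

theorem mul_besselK_one_le {x : ℝ} (hx : 0 < x) : x * besselK 1 x ≤ 1 := by
  obtain ⟨hi, h1⟩ := integral_cosh_mul_exp_neg_sinh hx
  rw [← h1, besselK_one_eq_coshMoment, coshMoment, ← integral_const_mul]
  refine integral_mono ((integrable_cosh_pow_mul_exp 1 hx).const_mul x).integrableOn hi fun t => ?_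
  have := Real.cosh_pos t
  have := (Real.sinh_lt_cosh t).le
  simp only [pow_one, mul_assoc, neg_mul]
  gcongr

/-- The majorant with `sinh` is off by the factor `exp(-x (cosh t - sinh t)) = exp(-x e^{-t})`,
which is at least `1 - x` for `t > 0`. -/
theorem one_sub_le_mul_besselK_one {x : ℝ} (hx : 0 < x) : 1 - x ≤ x * besselK 1 x := by
  obtain ⟨hi, h1⟩ := integral_cosh_mul_exp_neg_sinh hx
  rw [← mul_one (1 - x)]
  nth_rw 2 [← h1]
  rw [besselK_one_eq_coshMoment, coshMoment, ← integral_const_mul, ← integral_const_mul]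
  refine setIntegral_mono_on (hi.const_mul _)
    ((integrable_cosh_pow_mul_exp 1 hx).const_mul x).integrableOn measurableSet_Ioi fun t ht => ?_
  have hc := Real.cosh_pos t
  have h2 : 1 - x ≤ Real.exp (-x * Real.exp (-t)) := by
    have h3 : Real.exp (-t) ≤ 1 := Real.exp_le_one_iff.2 (by linarith [Set.mem_Ioi.1 ht])
    have h4 := Real.add_one_le_exp (-x * Real.exp (-t))
    nlinarith
  calc _ ≤ Real.exp (-x * Real.exp (-t)) *
        (x * Real.cosh t * Real.exp (-x * Real.sinh t)) := by gcongr
    _ = _ := by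
      rw [← Real.cosh_sub_sinh, pow_one, show -x * Real.cosh t =
        -x * (Real.cosh t - Real.sinh t) + -x * Real.sinh t by ring, Real.exp_add]
      ring

theorem tendsto_mul_besselK_one_zero :
    Tendsto (fun x => x * besselK 1 x) (𝓝[>] 0) (𝓝 1) := by
  refine tendsto_of_tendsto_of_tendsto_of_le_of_le' (g := fun x => 1 - x) (h := fun _ => 1)
    ?_ tendsto_const_nhds ?_ ?_
  · refine Tendsto.mono_left ?_ nhdsWithin_le_nhds
    exact Continuous.tendsto' (by fun_prop) _ _ (by simp)
  · filter_upwards [self_mem_nhdsWithin] with x hx using one_sub_le_mul_besselK_one hx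
  · filter_upwards [self_mem_nhdsWithin] with x hx using mul_besselK_one_le hx

/-- The crude bound `x² K₀ ≤ x · (x K₁) ≤ x` suffices, so the logarithmic asymptotics of `K₀` are
not needed. -/
theorem tendsto_sq_mul_besselK_zero :
    Tendsto (fun x => x ^ 2 * besselK 0 x) (𝓝[>] 0) (𝓝 0) := by
  refine squeeze_zero' (g := fun x => x) ?_ ?_ (tendsto_id.mono_left nhdsWithin_le_nhds)
  · filter_upwards with x using mul_nonneg (sq_nonneg x) (besselK_zero_nonneg x)
  · filter_upwards [self_mem_nhdsWithin] with x hx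
    rw [Set.mem_Ioi] at hx
    have h1 := mul_besselK_one_le hx
    have h2 := besselK_zero_le_one hx
    nlinarith [mul_le_mul_of_nonneg_left h2 hx.le]

/-- For `x ≥ 1` one has `K₁(x) ≤ exp(1 - x) K₁(1)`, because `(x - 1)(cosh t - 1) ≥ 0`. -/
theorem tendsto_mul_besselK_one_atTop :
    Tendsto (fun x => x * besselK 1 x) atTop (𝓝 0) := by
  have h1 : Tendsto (fun x : ℝ => x ^ 1 * Real.exp (-x) * (Real.exp 1 * besselK 1 1)) atTop
      (𝓝 0) := by
    simpa using (Real.tendsto_pow_mul_exp_neg_atTop_nhds_zero 1).mul_const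
      (Real.exp 1 * besselK 1 1)
  refine squeeze_zero' ?_ ?_ h1
  · filter_upwards [eventually_gt_atTop 0] with x hx using
      mul_nonneg hx.le ((besselK_zero_nonneg x).trans (besselK_zero_le_one hx))
  · filter_upwards [eventually_ge_atTop 1] with x hx
    have hx0 : 0 < x := by linarith
    rw [pow_one, mul_assoc]
    gcongr
    rw [besselK_one_eq_coshMoment, coshMoment, coshMoment, ← mul_assoc, ← integral_const_mul]
    refine integral_mono (integrable_cosh_pow_mul_exp 1 hx0).integrableOn
      ((integrable_cosh_pow_mul_exp 1 one_pos).const_mul _).integrableOn fun t => ?_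
    have hc := Real.one_le_cosh t
    calc _ ≤ Real.cosh t ^ 1 * Real.exp (-x + 1 + -1 * Real.cosh t) := by
          gcongr
          nlinarith
      _ = _ := by
        rw [Real.exp_add, Real.exp_add]
        ring

/-! ### Angular integrals producing `I₀`. -/

/-- Termwise integration of the exponential series. -/
theorem hasSum_integral_exp_mul {α : Type*} [MeasurableSpace α] {μ : Measure α}
    {w G : α → ℂ} (hw : Measurable w) (hw1 : ∀ θ, ‖w θ‖ ≤ 1) (hG : Integrable G μ) (p : ℂ) :
    HasSum (fun m : ℕ => p ^ m / (m.factorial : ℂ) * ∫ θ, w θ ^ m * G θ ∂μ)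
      (∫ θ, Complex.exp (p * w θ) * G θ ∂μ) := by
  have hle : ∀ m θ, ‖w θ ^ m * G θ‖ ≤ ‖G θ‖ := fun m θ => by
    rw [norm_mul, norm_pow]
    exact mul_le_of_le_one_left (norm_nonneg _) (pow_le_one₀ (norm_nonneg _) (hw1 θ))
  have hint : ∀ m : ℕ, Integrable (fun θ => w θ ^ m * G θ) μ := fun m =>
    hG.mono ((hw.pow_const m).aestronglyMeasurable.mul hG.1) (Eventually.of_forall (hle m))
  have h := hasSum_integral_of_summable_integral_norm (μ := μ)
    (F := fun (m : ℕ) θ => p ^ m / (m.factorial : ℂ) * (w θ ^ m * G θ))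
    (fun m => (hint m).const_mul _) (by
      refine Summable.of_nonneg_of_le (fun m => integral_nonneg fun θ => norm_nonneg _)
        (fun m => ?_) ((Real.summable_pow_div_factorial ‖p‖).mul_right (∫ θ, ‖G θ‖ ∂μ))
      rw [← integral_const_mul]
      refine integral_mono ((hint m).const_mul _).norm (hG.norm.const_mul _) fun θ => ?_
      simp only
      rw [norm_mul, norm_div, norm_pow, Complex.norm_natCast]
      gcongr
      exact hle m θ)
  simp only [integral_const_mul] at h
  rw [show (fun θ => Complex.exp (p * w θ) * G θ) =
    fun θ => ∑' m : ℕ, p ^ m / (m.factorial : ℂ) * (w θ ^ m * G θ) from ?_]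
  · exact h
  ext θ
  have h2 := (NormedSpace.expSeries_div_hasSum_exp (p * w θ)).mul_right (G θ)
  rw [← Complex.exp_eq_exp_ℂ] at h2
  rw [← h2.tsum_eq]
  refine tsum_congr fun m => ?_
  rw [mul_pow]
  ring

theorem norm_exp_real_mul_I (θ : ℝ) : ‖Complex.exp (θ * Complex.I)‖ = 1 :=
  Complex.norm_exp_ofReal_mul_I θ

theorem integral_exp_int_mul_I (n : ℤ) :
    ∫ θ in Set.Ioo (-Real.pi) Real.pi, Complex.exp (n * Complex.I * θ) =
      if n = 0 then 2 * (Real.pi : ℂ) else 0 := by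
  rw [← integral_Ioc_eq_integral_Ioo, ← intervalIntegral.integral_of_le (by
    linarith [Real.pi_pos])]
  split_ifs with hn
  · subst hn
    simp
    ring
  · rw [integral_exp_mul_complex (by simpa using hn)]
    have h : Complex.exp (n * Complex.I * (Real.pi : ℝ)) =
        Complex.exp (n * Complex.I * ((-Real.pi : ℝ) : ℂ)) := by
      rw [Complex.exp_eq_exp_iff_exists_int]
      refine ⟨n, ?_⟩
      push_cast
      ring
    rw [h, sub_self, zero_div]

theorem integrable_exp_Ioo {f : ℝ → ℂ} (hf : Continuous f) :
    Integrable f (volume.restrict (Set.Ioo (-Real.pi) Real.pi)) :=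
  (hf.integrableOn_Icc).mono_set Set.Ioo_subset_Icc_self

/-- Both exponentials are expanded in turn; orthogonality of the characters `e^{inθ}` keeps only the
diagonal terms. -/
theorem hasSum_integral_exp_add_exp (p q : ℂ) :
    HasSum (fun m : ℕ => p ^ m / (m.factorial : ℂ) *
        (2 * Real.pi * (q ^ m / (m.factorial : ℂ))))
      (∫ θ in Set.Ioo (-Real.pi) Real.pi,
        Complex.exp (p * Complex.exp (θ * Complex.I) + q * Complex.exp (-(θ * Complex.I)))) := by
  have hw : ∀ θ : ℝ, ‖Complex.exp (-(θ * Complex.I))‖ ≤ 1 := fun θ => by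
    have := norm_exp_real_mul_I (-θ)
    push_cast at this
    rw [neg_mul] at this
    exact this.le
  have h1 := hasSum_integral_exp_mul (μ := volume.restrict (Set.Ioo (-Real.pi) Real.pi))
    (w := fun θ : ℝ => Complex.exp (θ * Complex.I))
    (G := fun θ : ℝ => Complex.exp (q * Complex.exp (-(θ * Complex.I)))) (by fun_prop)
    (fun θ => (norm_exp_real_mul_I θ).le) (integrable_exp_Ioo (by fun_prop)) p
  simp only [← Complex.exp_add] at h1
  convert h1 using 3 with m
  have h2 := hasSum_integral_exp_mul (μ := volume.restrict (Set.Ioo (-Real.pi) Real.pi))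
    (w := fun θ : ℝ => Complex.exp (-(θ * Complex.I)))
    (G := fun θ : ℝ => Complex.exp (θ * Complex.I) ^ m) (by fun_prop)
    hw (integrable_exp_Ioo (by fun_prop)) q
  have h3 : ∀ n : ℕ, ∫ θ in Set.Ioo (-Real.pi) Real.pi,
      Complex.exp (-(θ * Complex.I)) ^ n * Complex.exp (θ * Complex.I) ^ m =
      if n = m then 2 * (Real.pi : ℂ) else 0 := fun n => by
    have := integral_exp_int_mul_I ((m : ℤ) - n)
    simp only [sub_eq_zero, Nat.cast_inj] at this
    rw [if_congr (eq_comm (a := n)) rfl rfl, ← this]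
    refine integral_congr_ae (Eventually.of_forall fun θ => ?_)
    simp only
    rw [← Complex.exp_nat_mul, ← Complex.exp_nat_mul, ← Complex.exp_add]
    push_cast
    ring_nf
  simp only [h3] at h2
  have h4 := h2.unique (hasSum_single m fun n hn => by rw [if_neg hn, mul_zero])
  rw [if_pos rfl] at h4
  rw [mul_comm (2 * (Real.pi : ℂ)), ← h4]
  refine integral_congr_ae (Eventually.of_forall fun θ => ?_)
  simp only
  rw [mul_comm]

/-- The diagonal series involves `p` and `q` only through `p q`, which frees the mean value formula
from the variable `t`. -/
theorem integral_exp_add_exp_eq_besselI {p q : ℂ} {R : ℝ} (hpq : p * q = ((R / 2 : ℝ) : ℂ) ^ 2) :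
    ∫ θ in Set.Ioo (-Real.pi) Real.pi,
        Complex.exp (p * Complex.exp (θ * Complex.I) + q * Complex.exp (-(θ * Complex.I))) =
      2 * Real.pi * besselI 0 R := by
  have h1 := hasSum_integral_exp_add_exp p q
  have h2 := (Complex.hasSum_ofReal.2 (hasSum_besselI_zero R)).mul_left (2 * (Real.pi : ℂ))
  refine h1.unique ?_
  refine (congrArg (HasSum · _) (funext fun m => ?_)).mp h2
  push_cast at hpq ⊢
  rw [← hpq, mul_pow]
  ring

/-! ### Contour shift and the circular mean of `K₀`. -/

theorem integral_exp_neg_mul_cosh_eq {x : ℝ} :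
    ∫ t : ℝ, Real.exp (-x * Real.cosh t) = 2 * besselK 0 x := by
  rw [besselK_zero_eq_coshMoment, coshMoment, ← integral_comp_abs]
  simp

theorem re_cosh_add_mul_I (t α : ℝ) :
    (Complex.cosh (t + α * Complex.I)).re = Real.cosh t * Real.cos α := by
  rw [Complex.cosh_add, Complex.cosh_mul_I, Complex.sinh_mul_I, ← Complex.ofReal_cosh,
    ← Complex.ofReal_cos, ← Complex.ofReal_sinh, ← Complex.ofReal_sin]
  simp only [Complex.add_re, Complex.re_ofReal_mul, Complex.ofReal_re, Complex.I_re, mul_zero,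
    add_zero]

theorem norm_sinh_add_mul_I_le (t α : ℝ) :
    ‖Complex.sinh (t + α * Complex.I)‖ ≤ Real.cosh t := by
  rw [Complex.sinh, Real.cosh_eq, norm_div]
  have h1 : ‖Complex.exp (t + α * Complex.I)‖ = Real.exp t := by simp [Complex.norm_exp]
  have h2 : ‖Complex.exp (-(t + α * Complex.I))‖ = Real.exp (-t) := by simp [Complex.norm_exp]
  have h3 := norm_sub_le (Complex.exp (t + α * Complex.I)) (Complex.exp (-(t + α * Complex.I)))
  rw [h1, h2] at h3
  simpa using div_le_div_of_nonneg_right h3 zero_le_two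

theorem norm_exp_neg_mul_cosh (x t α : ℝ) :
    ‖Complex.exp (-x * Complex.cosh (t + α * Complex.I))‖ =
      Real.exp (-(x * Real.cos α) * Real.cosh t) := by
  rw [Complex.norm_exp]
  congr 1
  rw [← Complex.ofReal_neg, Complex.re_ofReal_mul, re_cosh_add_mul_I]
  ring

theorem integrable_exp_neg_mul_cosh_add {x α : ℝ} (hx : 0 < x) (hα : 0 < Real.cos α) :
    Integrable fun t : ℝ => Complex.exp (-x * Complex.cosh (t + α * Complex.I)) := by
  refine (integrable_exp_neg_mul_cosh (mul_pos hx hα)).mono' (by fun_prop)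
    (Eventually.of_forall fun t => ?_)
  rw [norm_exp_neg_mul_cosh]

theorem norm_sinh_mul_exp_le {x α c : ℝ} (hx : 0 < x) (hα : c ≤ Real.cos α) (t : ℝ) :
    ‖-x * Complex.sinh (t + α * Complex.I) * Complex.I *
        Complex.exp (-x * Complex.cosh (t + α * Complex.I))‖ ≤
      x * (Real.cosh t ^ 1 * Real.exp (-(x * c) * Real.cosh t)) := by
  have := Real.cosh_pos t
  rw [norm_mul, norm_mul, norm_mul, norm_neg, Complex.norm_real, Complex.norm_I, mul_one,
    norm_exp_neg_mul_cosh, Real.norm_of_nonneg hx.le, pow_one, mul_assoc]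
  gcongr
  exact norm_sinh_add_mul_I_le t α

/-- By holomorphy the derivative in `α` is `i` times the derivative in `t`, whose integral over the
line is zero. On the strip `|α| < β < π/2` the bound `cos α ≥ cos β > 0` gives a uniform integrable
majorant. -/
theorem hasDerivAt_integral_exp_neg_mul_cosh_add {x β α : ℝ} (hx : 0 < x)
    (hβ : β < Real.pi / 2) (hα : α ∈ Set.Ioo (-β) β) :
    HasDerivAt (fun α : ℝ => ∫ t : ℝ, Complex.exp (-x * Complex.cosh (t + α * Complex.I))) 0 α := by
  have hβ0 : 0 < β := by linarith [hα.1, hα.2]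
  have hc : 0 < Real.cos β := Real.cos_pos_of_mem_Ioo ⟨by linarith, hβ⟩
  have hle : ∀ α ∈ Set.Ioo (-β) β, Real.cos β ≤ Real.cos α := fun α hα => by
    rw [← Real.cos_abs α]
    exact Real.cos_le_cos_of_nonneg_of_le_pi (abs_nonneg _) (by linarith) (abs_lt.2 hα).le
  have hdc : ∀ t α : ℝ, HasDerivAt (fun z : ℂ => Complex.exp (-x * Complex.cosh z))
      (-x * Complex.sinh (t + α * Complex.I) *
        Complex.exp (-x * Complex.cosh (t + α * Complex.I))) (t + α * Complex.I) := fun t α => by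
    refine (((Complex.hasDerivAt_cosh _).const_mul (-(x : ℂ))).cexp).congr_deriv ?_
    ring
  have hda : ∀ t α : ℝ, HasDerivAt
      (fun α : ℝ => Complex.exp (-x * Complex.cosh (t + α * Complex.I)))
      (-x * Complex.sinh (t + α * Complex.I) * Complex.I *
        Complex.exp (-x * Complex.cosh (t + α * Complex.I))) α := fun t α => by
    have h1 : HasDerivAt (fun α : ℝ => (t : ℂ) + α * Complex.I) Complex.I α := by
      simpa using ((Complex.ofRealCLM.hasDerivAt (x := α)).mul_const Complex.I).const_add (t : ℂ)
    refine ((hdc t α).comp α h1).congr_deriv ?_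
    ring
  have hdt : ∀ t : ℝ, HasDerivAt
      (fun t : ℝ => Complex.I * Complex.exp (-x * Complex.cosh (t + α * Complex.I)))
      (-x * Complex.sinh (t + α * Complex.I) * Complex.I *
        Complex.exp (-x * Complex.cosh (t + α * Complex.I))) t := fun t => by
    have h1 : HasDerivAt (fun t : ℝ => (t : ℂ) + α * Complex.I) 1 t :=
      (Complex.ofRealCLM.hasDerivAt (x := t)).add_const _
    refine (((hdc t α).comp t h1).const_mul Complex.I).congr_deriv ?_
    ring
  have h := hasDerivAt_integral_of_dominated_loc_of_deriv_le (𝕜 := ℝ) (μ := volume)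
    (s := Set.Ioo (-β) β) (x₀ := α)
    (F := fun (α t : ℝ) => Complex.exp (-x * Complex.cosh (t + α * Complex.I)))
    (F' := fun (α t : ℝ) => -x * Complex.sinh (t + α * Complex.I) * Complex.I *
        Complex.exp (-x * Complex.cosh (t + α * Complex.I)))
    (bound := fun t => x * (Real.cosh t ^ 1 * Real.exp (-(x * Real.cos β) * Real.cosh t)))
    (Ioo_mem_nhds hα.1 hα.2) (Eventually.of_forall fun y => by fun_prop)
    (integrable_exp_neg_mul_cosh_add hx (hc.trans_le (hle α hα))) (by fun_prop)
    (Eventually.of_forall fun t y hy => norm_sinh_mul_exp_le hx (hle y hy) t)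
    ((integrable_cosh_pow_mul_exp 1 (mul_pos hx hc)).const_mul x)
    (Eventually.of_forall fun t y _ => hda t y)
  refine h.2.congr_deriv ?_
  exact integral_eq_zero_of_hasDerivAt_of_integrable hdt h.1
    ((integrable_exp_neg_mul_cosh_add hx (hc.trans_le (hle α hα))).const_mul _)

/-- The contour of integration for `K₀` may be shifted by `α i` with `|α| < π / 2`. -/
theorem integral_exp_neg_mul_cosh_add {x α : ℝ} (hx : 0 < x) (hα : |α| < Real.pi / 2) :
    ∫ t : ℝ, Complex.exp (-x * Complex.cosh (t + α * Complex.I)) = 2 * besselK 0 x := by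
  obtain ⟨β, h1, h2⟩ := exists_between hα
  have hd := fun y hy => hasDerivAt_integral_exp_neg_mul_cosh_add (α := y) hx h2 hy
  have h := isOpen_Ioo.is_const_of_deriv_eq_zero isPreconnected_Ioo
    (fun y hy => (hd y hy).differentiableAt.differentiableWithinAt)
    (fun y hy => (hd y hy).deriv) (abs_lt.1 h1) (y := 0)
    (abs_lt.1 (by rw [abs_zero]; exact (abs_nonneg α).trans_lt h1))
  rw [h]
  simp only [Complex.ofReal_zero, zero_mul, add_zero]
  have h3 : ((∫ t : ℝ, Real.exp (-x * Real.cosh t) : ℝ) : ℂ) = ((2 * besselK 0 x : ℝ) : ℂ) :=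
    congrArg _ integral_exp_neg_mul_cosh_eq
  rw [← integral_complex_ofReal] at h3
  push_cast at h3
  exact h3

/-- With `z = X + iY`, the exponent is `-|z| cosh(t + i arg z)`, and `X > 0` means `|arg z| < π/2`,
so the shifted contour applies. -/
theorem integral_exp_cosh_sinh {X : ℝ} (hX : 0 < X) (Y : ℝ) :
    ∫ t : ℝ, Complex.exp (-(X * Complex.cosh t + Y * Complex.sinh t * Complex.I)) =
      2 * besselK 0 (Real.sqrt (X ^ 2 + Y ^ 2)) := by
  set z : ℂ := ⟨X, Y⟩ with hz
  have hz0 : z ≠ 0 := fun h => hX.ne' (congrArg Complex.re h)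
  have hn : ‖z‖ = Real.sqrt (X ^ 2 + Y ^ 2) := by
    rw [Complex.norm_def, Complex.normSq_mk]
    ring_nf
  have h := integral_exp_neg_mul_cosh_add (norm_pos_iff.2 hz0)
    (Complex.abs_arg_lt_pi_div_two_iff.2 (Or.inl hX) : |z.arg| < Real.pi / 2)
  rw [← hn, ← h]
  refine integral_congr_ae (Eventually.of_forall fun t => ?_)
  have h1 : (‖z‖ : ℂ) * Complex.cos z.arg = X := by
    rw [← Complex.ofReal_cos, ← Complex.ofReal_mul, Complex.norm_mul_cos_arg]
  have h2 : (‖z‖ : ℂ) * Complex.sin z.arg = Y := by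
    rw [← Complex.ofReal_sin, ← Complex.ofReal_mul, Complex.norm_mul_sin_arg]
  simp only
  rw [Complex.cosh_add, Complex.cosh_mul_I, Complex.sinh_mul_I, ← h1, ← h2]
  ring_nf

/-- Mean value of `K₀` over a circle that does not enclose its singularity. -/
theorem integral_besselK_circle {R D : ℝ} (hR : 0 ≤ R) (hRD : R < D) :
    ∫ θ in Set.Ioo (-Real.pi) Real.pi,
        besselK 0 (Real.sqrt ((R * Real.cos θ - D) ^ 2 + (R * Real.sin θ) ^ 2)) =
      2 * Real.pi * (besselI 0 R * besselK 0 D) := by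
  set E : ℝ → ℝ → ℂ := fun θ t => Complex.exp (-((D - R * Real.cos θ : ℝ) * Complex.cosh t +
    (R * Real.sin θ : ℝ) * Complex.sinh t * Complex.I)) with hE
  -- Here `R < D` enters: the whole circle stays in the half-plane where the exponential
  -- representation converges, uniformly in `θ`.
  have hpos : ∀ θ : ℝ, D - R ≤ D - R * Real.cos θ := fun θ => by
    nlinarith [Real.cos_le_one θ]
  have h1 : ∀ θ : ℝ, ∫ t : ℝ, E θ t =
      2 * besselK 0 (Real.sqrt ((R * Real.cos θ - D) ^ 2 + (R * Real.sin θ) ^ 2)) := fun θ => by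
    rw [integral_exp_cosh_sinh (by linarith [hpos θ])]
    ring_nf
  have hint : Integrable (Function.uncurry E)
      ((volume.restrict (Set.Ioo (-Real.pi) Real.pi)).prod volume) := by
    refine ((integrable_exp_neg_mul_cosh (c := D - R) (by linarith)).comp_snd
      (volume.restrict (Set.Ioo (-Real.pi) Real.pi))).mono' ?_ (Eventually.of_forall ?_)
    · exact Continuous.aestronglyMeasurable (by fun_prop)
    · rintro ⟨θ, t⟩
      simp only [Function.uncurry, hE, Complex.norm_exp]
      rw [← Complex.ofReal_cosh, ← Complex.ofReal_sinh, ← Complex.ofReal_mul, ← Complex.ofReal_mul]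
      simp only [Complex.neg_re, Complex.add_re, Complex.ofReal_re, Complex.re_ofReal_mul,
        Complex.I_re, mul_zero, add_zero]
      rw [neg_mul]
      gcongr
      linarith [hpos θ]
  have h2 : ∀ t : ℝ, ∫ θ in Set.Ioo (-Real.pi) Real.pi, E θ t =
      (Real.exp (-D * Real.cosh t) : ℂ) * (2 * Real.pi * besselI 0 R) := fun t => by
    -- The factors `e^{-t}` and `e^{t}` cancel in `p q = (R/2)²`, so the angular integral
    -- contributes `I₀(R)` for every `t`.
    rw [← integral_exp_add_exp_eq_besselI (p := R / 2 * Complex.exp (-t))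
      (q := R / 2 * Complex.exp t) (R := R), ← integral_const_mul]
    · refine integral_congr_ae (Eventually.of_forall fun θ => ?_)
      simp only [hE]
      push_cast
      rw [← Complex.exp_add]
      congr 1
      rw [Complex.exp_mul_I, ← neg_mul, Complex.exp_mul_I, Complex.cos_neg,
        Complex.sin_neg, ← Complex.cosh_add_sinh t, ← Complex.cosh_sub_sinh t]
      ring
    · rw [mul_mul_mul_comm, ← Complex.exp_add]
      simp
      ring
  have h3 := integral_integral_swap hint
  simp only [h1, h2] at h3
  rw [integral_const_mul, integral_mul_const] at h3
  have h4 : ((∫ t : ℝ, Real.exp (-D * Real.cosh t) : ℝ) : ℂ) = ((2 * besselK 0 D : ℝ) : ℂ) :=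
    congrArg _ integral_exp_neg_mul_cosh_eq
  rw [← integral_complex_ofReal] at h4
  rw [h4, integral_complex_ofReal] at h3
  have h5 : (2 : ℝ) * ∫ θ in Set.Ioo (-Real.pi) Real.pi,
      besselK 0 (Real.sqrt ((R * Real.cos θ - D) ^ 2 + (R * Real.sin θ) ^ 2)) =
      2 * besselK 0 D * (2 * Real.pi * besselI 0 R) := by
    exact_mod_cast h3
  linarith

/-! ### Radial integrals and the Wronskian. -/

theorem hasDerivAt_besselJ_zero_mul (Λ r : ℝ) :
    HasDerivAt (fun r => besselJ 0 (Λ * r)) (-(Λ * besselJ 1 (Λ * r))) r := by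
  refine ((hasDerivAt_besselJ_zero (Λ * r)).comp r ((hasDerivAt_id r).const_mul Λ)).congr_deriv ?_
  ring

theorem hasDerivAt_mul_besselJ_one_mul {Λ : ℝ} (hΛ : 0 < Λ) (r : ℝ) :
    HasDerivAt (fun r => r * besselJ 1 (Λ * r)) (Λ * (r * besselJ 0 (Λ * r))) r := by
  have h := (((hasDerivAt_mul_besselJ_one (Λ * r)).comp r
    ((hasDerivAt_id r).const_mul Λ))).const_mul Λ⁻¹
  refine (h.congr_deriv ?_).congr_of_eventuallyEq (Eventually.of_forall fun r => ?_)
  · field_simp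
  · simp only [Function.comp_apply]
    field_simp

theorem hasDerivAt_besselI_zero_mul (Γ r : ℝ) :
    HasDerivAt (fun r => besselI 0 (Γ * r)) (Γ * besselI 1 (Γ * r)) r := by
  refine ((hasDerivAt_besselI_zero (Γ * r)).comp r ((hasDerivAt_id r).const_mul Γ)).congr_deriv ?_
  ring

theorem hasDerivAt_mul_besselI_one_mul {Γ : ℝ} (hΓ : 0 < Γ) (r : ℝ) :
    HasDerivAt (fun r => r * besselI 1 (Γ * r)) (Γ * (r * besselI 0 (Γ * r))) r := by
  have h := (((hasDerivAt_mul_besselI_one (Γ * r)).comp r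
    ((hasDerivAt_id r).const_mul Γ))).const_mul Γ⁻¹
  refine (h.congr_deriv ?_).congr_of_eventuallyEq (Eventually.of_forall fun r => ?_)
  · field_simp
  · simp only [Function.comp_apply]
    field_simp

theorem hasDerivAt_besselK_zero_mul {Γ r : ℝ} (hΓ : 0 < Γ) (hr : 0 < r) :
    HasDerivAt (fun r => besselK 0 (Γ * r)) (-(Γ * besselK 1 (Γ * r))) r := by
  refine ((hasDerivAt_besselK_zero (mul_pos hΓ hr)).comp r
    ((hasDerivAt_id r).const_mul Γ)).congr_deriv ?_
  ring

theorem hasDerivAt_mul_besselK_one_mul {Γ r : ℝ} (hΓ : 0 < Γ) (hr : 0 < r) :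
    HasDerivAt (fun r => r * besselK 1 (Γ * r)) (-(Γ * (r * besselK 0 (Γ * r)))) r := by
  have h := (((hasDerivAt_mul_besselK_one (mul_pos hΓ hr)).comp r
    ((hasDerivAt_id r).const_mul Γ))).const_mul Γ⁻¹
  refine (h.congr_deriv ?_).congr_of_eventuallyEq (Eventually.of_forall fun r => ?_)
  · field_simp
  · simp only [Function.comp_apply]
    field_simp

/-- Lagrange's identity: for `u = J₀(Λ r)`, `v = I₀(Γ r)` one has `(r u')' = -Λ² r u` and `(r v')' =
Γ² r v`, so `r (u v' - u' v)` has derivative `(Γ² + Λ²) r u v`. -/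
theorem integral_mul_besselJ_mul_besselI {Λ Γ a : ℝ} (hΛ : 0 < Λ) (hΓ : 0 < Γ) (ha : 0 < a) :
    ∫ r in Set.Ioc 0 a, r * (besselJ 0 (Λ * r) * besselI 0 (Γ * r)) =
      a / (Γ ^ 2 + Λ ^ 2) * (Λ * besselI 0 (Γ * a) * besselJ 1 (Λ * a) +
        Γ * besselJ 0 (Λ * a) * besselI 1 (Γ * a)) := by
  have hJ := continuous_besselJ_zero
  have hI := continuous_besselI_zero
  have hd : ∀ r ∈ Set.uIcc 0 a, HasDerivAt (fun r => (Γ ^ 2 + Λ ^ 2)⁻¹ *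
      (Γ * (besselJ 0 (Λ * r) * (r * besselI 1 (Γ * r))) +
        Λ * (r * besselJ 1 (Λ * r) * besselI 0 (Γ * r))))
      (r * (besselJ 0 (Λ * r) * besselI 0 (Γ * r))) r := fun r _ => by
    refine (((((hasDerivAt_besselJ_zero_mul Λ r).mul
      (hasDerivAt_mul_besselI_one_mul hΓ r)).const_mul Γ).add
      (((hasDerivAt_mul_besselJ_one_mul hΛ r).mul
      (hasDerivAt_besselI_zero_mul Γ r)).const_mul Λ)).const_mul _).congr_deriv ?_
    have : Γ ^ 2 + Λ ^ 2 ≠ 0 := by positivity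
    field_simp
    ring
  rw [← intervalIntegral.integral_of_le ha.le, intervalIntegral.integral_eq_sub_of_hasDerivAt hd
    (Continuous.intervalIntegrable (by fun_prop) _ _)]
  ring

theorem integral_mul_besselJ_sq {Λ a : ℝ} (hΛ : 0 < Λ) (ha : 0 < a) :
    ∫ r in Set.Ioc 0 a, r * besselJ 0 (Λ * r) ^ 2 =
      a ^ 2 / 2 * (besselJ 1 (Λ * a) ^ 2 + besselJ 0 (Λ * a) ^ 2) := by
  have hJ := continuous_besselJ_zero
  have hd : ∀ r ∈ Set.uIcc 0 a, HasDerivAt (fun r => 2⁻¹ *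
      ((r * besselJ 0 (Λ * r)) ^ 2 + (r * besselJ 1 (Λ * r)) ^ 2))
      (r * besselJ 0 (Λ * r) ^ 2) r := fun r _ => by
    refine (((((hasDerivAt_id r).mul (hasDerivAt_besselJ_zero_mul Λ r)).pow 2).add
      ((hasDerivAt_mul_besselJ_one_mul hΛ r).pow 2)).const_mul _).congr_deriv ?_
    simp only [Pi.mul_apply, id]
    push_cast
    ring
  rw [← intervalIntegral.integral_of_le ha.le, intervalIntegral.integral_eq_sub_of_hasDerivAt hd
    (Continuous.intervalIntegrable (by fun_prop) _ _)]
  ring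

theorem tendsto_const_mul_zero_right {Γ : ℝ} (hΓ : 0 < Γ) :
    Tendsto (fun r => Γ * r) (𝓝[>] 0) (𝓝[>] 0) := by
  refine tendsto_nhdsWithin_iff.2 ⟨?_, ?_⟩
  · exact (Continuous.tendsto' (by fun_prop) _ _ (by simp)).mono_left nhdsWithin_le_nhds
  · filter_upwards [self_mem_nhdsWithin] with r hr using mul_pos hΓ hr

theorem tendsto_mul_besselK_one_mul_zero {Γ : ℝ} (hΓ : 0 < Γ) :
    Tendsto (fun r => r * besselK 1 (Γ * r)) (𝓝[>] 0) (𝓝 Γ⁻¹) := by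
  have h := (tendsto_mul_besselK_one_zero.comp (tendsto_const_mul_zero_right hΓ)).const_mul Γ⁻¹
  rw [mul_one] at h
  refine h.congr fun r => ?_
  simp only [Function.comp_apply]
  field_simp

theorem tendsto_sq_mul_besselK_zero_mul {Γ : ℝ} (hΓ : 0 < Γ) :
    Tendsto (fun r => r ^ 2 * besselK 0 (Γ * r)) (𝓝[>] 0) (𝓝 0) := by
  have h := (tendsto_sq_mul_besselK_zero.comp (tendsto_const_mul_zero_right hΓ)).const_mul
    (Γ ^ 2)⁻¹
  rw [mul_zero] at h
  refine h.congr fun r => ?_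
  simp only [Function.comp_apply]
  field_simp

theorem integral_mul_besselK_mul_besselI {Γ a : ℝ} (hΓ : 0 < Γ) (ha : 0 < a) :
    IntegrableOn (fun r => r * (besselK 0 (Γ * r) * besselI 0 (Γ * r))) (Set.Ioc 0 a) ∧
    ∫ r in Set.Ioc 0 a, r * (besselK 0 (Γ * r) * besselI 0 (Γ * r)) =
      a ^ 2 / 2 * (besselI 0 (Γ * a) * besselK 0 (Γ * a) +
        besselI 1 (Γ * a) * besselK 1 (Γ * a)) := by
  set F : ℝ → ℝ := fun r => 2⁻¹ * (r ^ 2 * besselK 0 (Γ * r) * besselI 0 (Γ * r) +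
    r * besselI 1 (Γ * r) * (r * besselK 1 (Γ * r))) with hF
  have hd : ∀ r, 0 < r → HasDerivAt F (r * (besselK 0 (Γ * r) * besselI 0 (Γ * r))) r :=
    fun r hr => by
    refine ((((((hasDerivAt_id r).pow 2).mul (hasDerivAt_besselK_zero_mul hΓ hr)).mul
      (hasDerivAt_besselI_zero_mul Γ r)).add ((hasDerivAt_mul_besselI_one_mul hΓ r).mul
      (hasDerivAt_mul_besselK_one_mul hΓ hr))).const_mul _).congr_deriv ?_
    simp only [Pi.mul_apply, Pi.pow_apply, id]
    push_cast
    ring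
  -- `K₀` and `K₁` are singular at zero, but the weights `r²` and `r` make the primitive continuous
  -- there; integrability then follows from the nonnegativity of its derivative.
  have h0 : Tendsto F (𝓝[>] 0) (𝓝 (F 0)) := by
    have hI0 : Tendsto (fun r => besselI 0 (Γ * r)) (𝓝[>] 0) (𝓝 (besselI 0 (Γ * 0))) :=
      ((hasDerivAt_besselI_zero_mul Γ 0).continuousAt.tendsto).mono_left nhdsWithin_le_nhds
    have hI1 : Tendsto (fun r => r * besselI 1 (Γ * r)) (𝓝[>] 0) (𝓝 (0 * besselI 1 (Γ * 0))) :=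
      ((hasDerivAt_mul_besselI_one_mul hΓ 0).continuousAt.tendsto).mono_left nhdsWithin_le_nhds
    have h := (((tendsto_sq_mul_besselK_zero_mul hΓ).mul hI0).add
      (hI1.mul (tendsto_mul_besselK_one_mul_zero hΓ))).const_mul 2⁻¹
    simpa [hF] using h
  have hc : ContinuousOn F (Set.Icc 0 a) := by
    intro r hr
    rcases hr.1.eq_or_lt with h | h
    · rw [← h]
      exact (continuousWithinAt_Ioi_iff_Ici.1 h0).mono Set.Icc_subset_Ici_self
    · exact (hd r h).continuousAt.continuousWithinAt
  have hi := intervalIntegral.integrableOn_deriv_of_nonneg hc (fun r hr => hd r hr.1) fun r hr =>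
    mul_nonneg hr.1.le (mul_nonneg (besselK_zero_nonneg _) (besselI_zero_nonneg _))
  refine ⟨hi, ?_⟩
  rw [← intervalIntegral.integral_of_le ha.le,
    intervalIntegral.integral_eq_sub_of_hasDerivAt_of_le ha.le hc (fun r hr => hd r hr.1)
      ((intervalIntegrable_iff_integrableOn_Ioc_of_le ha.le).2 hi)]
  simp only [hF]
  ring

theorem hasDerivAt_besselK_sq_primitive {Γ r : ℝ} (hΓ : 0 < Γ) (hr : 0 < r) :
    HasDerivAt (fun r => 2⁻¹ * ((r * besselK 0 (Γ * r)) ^ 2 - (r * besselK 1 (Γ * r)) ^ 2))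
      (r * besselK 0 (Γ * r) ^ 2) r := by
  refine (((((hasDerivAt_id r).mul (hasDerivAt_besselK_zero_mul hΓ hr)).pow 2).sub
    ((hasDerivAt_mul_besselK_one_mul hΓ hr).pow 2)).const_mul _).congr_deriv ?_
  simp only [Pi.mul_apply, id]
  push_cast
  ring

theorem tendsto_besselK_sq_primitive {Γ : ℝ} (hΓ : 0 < Γ) :
    Tendsto (fun r => 2⁻¹ * ((r * besselK 0 (Γ * r)) ^ 2 - (r * besselK 1 (Γ * r)) ^ 2)) atTop
      (𝓝 0) := by
  have h1 : Tendsto (fun r => r * besselK 1 (Γ * r)) atTop (𝓝 0) := by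
    have h := (tendsto_mul_besselK_one_atTop.comp (tendsto_id.const_mul_atTop hΓ)).const_mul Γ⁻¹
    rw [mul_zero] at h
    refine h.congr fun r => ?_
    simp only [Function.comp_apply, id]
    field_simp
  have h0 : Tendsto (fun r => r * besselK 0 (Γ * r)) atTop (𝓝 0) := by
    refine squeeze_zero' ?_ ?_ h1
    · filter_upwards [eventually_gt_atTop 0] with r hr using
        mul_nonneg hr.le (besselK_zero_nonneg _)
    · filter_upwards [eventually_gt_atTop 0] with r hr using
        mul_le_mul_of_nonneg_left (besselK_zero_le_one (mul_pos hΓ hr)) hr.le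
  simpa using ((h0.pow 2).sub (h1.pow 2)).const_mul 2⁻¹

theorem integral_mul_besselK_sq {Γ a : ℝ} (hΓ : 0 < Γ) (ha : 0 < a) :
    ∫ r in Set.Ioi a, r * besselK 0 (Γ * r) ^ 2 =
      a ^ 2 / 2 * (besselK 1 (Γ * a) ^ 2 - besselK 0 (Γ * a) ^ 2) := by
  rw [integral_Ioi_of_hasDerivAt_of_nonneg'
    (fun r hr => hasDerivAt_besselK_sq_primitive hΓ (ha.trans_le hr))
    (fun r hr => mul_nonneg (ha.trans hr).le (sq_nonneg _)) (tendsto_besselK_sq_primitive hΓ)]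
  ring

/-- The primitive is monotone and, by `x K₁(x) ≤ 1`, bounded below by `-1/(2Γ²)`, so it has a finite
limit at `0⁺`; its limit at infinity is zero. -/
theorem integrableOn_mul_besselK_sq {Γ : ℝ} (hΓ : 0 < Γ) :
    IntegrableOn (fun r => r * besselK 0 (Γ * r) ^ 2) (Set.Ioi 0) := by
  set F : ℝ → ℝ := fun r =>
    2⁻¹ * ((r * besselK 0 (Γ * r)) ^ 2 - (r * besselK 1 (Γ * r)) ^ 2) with hF
  have h0 : ∃ y, Tendsto F (𝓝[>] 0) (𝓝 y) := by
    have hd := fun r (hr : r ∈ Set.Ioi (0 : ℝ)) => hasDerivAt_besselK_sq_primitive hΓ hr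
    have hm : MonotoneOn F (Set.Ioi 0) := by
      refine monotoneOn_of_deriv_nonneg (convex_Ioi 0)
        (fun r hr => (hd r hr).continuousAt.continuousWithinAt) ?_ ?_
      · rw [interior_Ioi]
        exact fun r hr => (hd r hr).differentiableAt.differentiableWithinAt
      · rw [interior_Ioi]
        intro r hr
        rw [(hd r hr).deriv]
        exact mul_nonneg (le_of_lt hr) (sq_nonneg _)
    refine ⟨_, hm.tendsto_nhdsGT ⟨-(2⁻¹ * Γ⁻¹ ^ 2), ?_⟩⟩
    rintro _ ⟨r, hr, rfl⟩
    rw [Set.mem_Ioi] at hr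
    have h1 : r * besselK 1 (Γ * r) ≤ Γ⁻¹ := by
      have h := mul_besselK_one_le (mul_pos hΓ hr)
      rw [inv_eq_one_div, le_div_iff₀ hΓ]
      linarith
    have h2 : 0 ≤ r * besselK 1 (Γ * r) := mul_nonneg hr.le
      ((besselK_zero_nonneg _).trans (besselK_zero_le_one (mul_pos hΓ hr)))
    have h3 := pow_le_pow_left₀ h2 h1 2
    have h4 := sq_nonneg (r * besselK 0 (Γ * r))
    simp only [hF]
    linarith
  obtain ⟨y, hy⟩ := h0
  -- The value of `F` at `0` need not be its limit, so it is replaced by `y` to obtain right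
  -- continuity.
  refine integrableOn_Ioi_deriv_of_nonneg (g := Function.update F 0 y) (l := 0) ?_ ?_ ?_ ?_
  · rw [continuousWithinAt_update_same, Set.Ici_sdiff_left]
    exact hy
  · intro r hr
    refine (hasDerivAt_besselK_sq_primitive hΓ hr).congr_of_eventuallyEq ?_
    filter_upwards [eventually_ne_nhds (ne_of_gt hr)] with s hs
    rw [Function.update_of_ne hs]
  · exact fun r hr => mul_nonneg (le_of_lt hr) (sq_nonneg _)
  · refine (tendsto_besselK_sq_primitive hΓ).congr' ?_
    filter_upwards [eventually_ne_atTop 0] with s hs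
    rw [Function.update_of_ne hs]

/-- The left side has zero derivative on `(0, ∞)`. Its limit at `0⁺` is `1`: `x K₁ → 1` with `I₀(0)
= 1`, while `x K₀` is bounded and `I₁ → 0`. -/
theorem mul_besselK_besselI_wronskian {x : ℝ} (hx : 0 < x) :
    x * (besselK 0 x * besselI 1 x + besselI 0 x * besselK 1 x) = 1 := by
  set F : ℝ → ℝ := fun x => besselK 0 x * (x * besselI 1 x) + besselI 0 x * (x * besselK 1 x)
    with hF
  have hd : ∀ y ∈ Set.Ioi (0 : ℝ), HasDerivAt F 0 y := fun y hy => by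
    refine (((hasDerivAt_besselK_zero hy).mul (hasDerivAt_mul_besselI_one y)).add
      ((hasDerivAt_besselI_zero y).mul (hasDerivAt_mul_besselK_one hy))).congr_deriv ?_
    ring
  have hI : Tendsto (besselI 1) (𝓝[>] 0) (𝓝 0) := by
    have h := hasDerivAt_iff_tendsto_slope.1 (hasDerivAt_mul_besselI_one 0)
    rw [zero_mul] at h
    refine (h.mono_left (nhdsWithin_mono 0 fun y hy => (ne_of_gt hy : y ≠ 0))).congr' ?_
    filter_upwards [self_mem_nhdsWithin] with y hy
    rw [slope_def_field]
    have : y ≠ 0 := ne_of_gt hy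
    simp only [zero_mul, sub_zero]
    field_simp
  have h1 : Tendsto (fun x => besselK 0 x * (x * besselI 1 x)) (𝓝[>] 0) (𝓝 0) := by
    refine squeeze_zero_norm' ?_ (by simpa using hI.norm)
    filter_upwards [self_mem_nhdsWithin] with y hy
    rw [Set.mem_Ioi] at hy
    have h2 : y * besselK 0 y ≤ 1 :=
      (mul_le_mul_of_nonneg_left (besselK_zero_le_one hy) hy.le).trans (mul_besselK_one_le hy)
    have h3 : 0 ≤ y * besselK 0 y := mul_nonneg hy.le (besselK_zero_nonneg y)
    rw [← mul_assoc, mul_comm (besselK 0 y), norm_mul, Real.norm_of_nonneg h3]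
    exact mul_le_of_le_one_left (norm_nonneg _) h2
  have hI0 : besselI 0 0 = 1 := by
    have h := hasSum_besselI_zero 0
    refine h.unique ?_
    convert hasSum_single 0 fun n hn => ?_ using 1
    · simp
    · simp [hn]
  have h2 : Tendsto F (𝓝[>] 0) (𝓝 1) := by
    have h3 := h1.add (((continuous_besselI_zero.tendsto 0).mono_left
      (nhdsWithin_le_nhds (s := Set.Ioi 0))).mul tendsto_mul_besselK_one_zero)
    rwa [hI0, zero_add, mul_one] at h3
  have h3 : Tendsto F (𝓝[>] 0) (𝓝 (F x)) := by
    refine tendsto_const_nhds.congr' ?_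
    filter_upwards [self_mem_nhdsWithin] with y hy
    exact isOpen_Ioi.is_const_of_deriv_eq_zero isPreconnected_Ioi
      (fun y hy => (hd y hy).differentiableAt.differentiableWithinAt)
      (fun y hy => (hd y hy).deriv) hx hy
  have h4 := tendsto_nhds_unique h3 h2
  rw [← h4]
  simp only [hF]
  ring

/-! ### Radial functions on the plane. -/

noncomputable section

/-- The function on the plane that depends through `f` on the distance to `(c, 0)`. -/
def radialAt (c : ℝ) (f : ℝ → ℝ) (p : ℝ × ℝ) : ℝ :=
  f (Real.sqrt ((p.1 - c) ^ 2 + p.2 ^ 2))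

end

theorem measurable_besselK_zero : Measurable (besselK 0) := by
  have h : StronglyMeasurable (Function.uncurry fun x t : ℝ =>
      Real.exp (-x * Real.cosh t) * Real.cosh (((0 : ℕ) : ℝ) * t)) :=
    Continuous.stronglyMeasurable (by fun_prop)
  exact (h.integral_prod_right (ν := volume.restrict (Set.Ioi (0 : ℝ)))).measurable

theorem measurable_radialAt {f : ℝ → ℝ} (hf : Measurable f) (c : ℝ) : Measurable (radialAt c f) :=
  hf.comp (by fun_prop)

theorem sqrt_polar {r : ℝ} (hr : 0 < r) (θ : ℝ) :
    Real.sqrt ((r * Real.cos θ - 0) ^ 2 + (r * Real.sin θ) ^ 2) = r := by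
  rw [sub_zero, mul_pow, mul_pow, ← mul_add, Real.cos_sq_add_sin_sq, mul_one, Real.sqrt_sq hr.le]

theorem integrable_iff_integrableOn_polarCoord_target {f : ℝ × ℝ → ℝ} :
    Integrable f ↔
      IntegrableOn (fun q : ℝ × ℝ => q.1 * f (polarCoord.symm q)) polarCoord.target := by
  have h := integrableOn_image_iff_integrableOn_abs_det_fderiv_smul volume
    polarCoord.open_target.measurableSet
    (fun q _ => (hasFDerivAt_polarCoord_symm q).hasFDerivWithinAt) polarCoord.symm.injOn f
  rw [polarCoord.symm_image_target_eq_source,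
    integrableOn_congr_set_ae polarCoord_source_ae_eq_univ, integrableOn_univ] at h
  rw [h]
  refine integrableOn_congr_fun (fun q hq => ?_) polarCoord.open_target.measurableSet
  rw [det_fderivPolarCoordSymm, abs_of_pos hq.1, smul_eq_mul]

theorem integrable_radialAt_zero {f : ℝ → ℝ}
    (hf : IntegrableOn (fun r => r * f r) (Set.Ioi 0)) : Integrable (radialAt 0 f) := by
  rw [integrable_iff_integrableOn_polarCoord_target, polarCoord_target]
  have h : IntegrableOn (fun q : ℝ × ℝ => q.1 * f q.1)
      (Set.Ioi 0 ×ˢ Set.Ioo (-Real.pi) Real.pi) := by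
    rw [IntegrableOn, Measure.volume_eq_prod, ← Measure.prod_restrict]
    exact Integrable.comp_fst hf _
  refine h.congr_fun (fun q hq => ?_) (measurableSet_Ioi.prod measurableSet_Ioo)
  simp only [radialAt, polarCoord_symm_apply, sqrt_polar hq.1]

/-- Integration in polar coordinates, the angle first. -/
theorem integral_eq_integral_polarCoord {f : ℝ × ℝ → ℝ} (hf : Integrable f) :
    IntegrableOn (fun r => ∫ θ in Set.Ioo (-Real.pi) Real.pi,
      r * f (r * Real.cos θ, r * Real.sin θ)) (Set.Ioi 0) ∧
    ∫ p, f p = ∫ r in Set.Ioi (0 : ℝ), ∫ θ in Set.Ioo (-Real.pi) Real.pi,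
      r * f (r * Real.cos θ, r * Real.sin θ) := by
  have h := integrable_iff_integrableOn_polarCoord_target.1 hf
  rw [polarCoord_target, IntegrableOn, Measure.volume_eq_prod, ← Measure.prod_restrict] at h
  refine ⟨h.integral_prod_left, ?_⟩
  rw [← integral_comp_polarCoord_symm, polarCoord_target, Measure.volume_eq_prod,
    ← Measure.prod_restrict]
  exact integral_prod _ h

theorem integral_radialAt_zero {f : ℝ → ℝ} (hf : IntegrableOn (fun r => r * f r) (Set.Ioi 0)) :
    ∫ p, radialAt 0 f p = 2 * Real.pi * ∫ r in Set.Ioi (0 : ℝ), r * f r := by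
  rw [(integral_eq_integral_polarCoord (integrable_radialAt_zero hf)).2, ← integral_const_mul]
  refine setIntegral_congr_fun measurableSet_Ioi fun r hr => ?_
  simp only [radialAt, sqrt_polar hr]
  rw [setIntegral_const, Real.volume_real_Ioo_of_le (by linarith [Real.pi_pos]), smul_eq_mul]
  ring

theorem integral_radialAt_mul_radialAt_translate (f g : ℝ → ℝ) (c d : ℝ) :
    ∫ p, radialAt c f p * radialAt d g p = ∫ p, radialAt 0 f p * radialAt (d - c) g p := by
  rw [← integral_sub_right_eq_self (fun p => radialAt 0 f p * radialAt (d - c) g p)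
    ((c, 0) : ℝ × ℝ)]
  refine integral_congr_ae (Eventually.of_forall fun p => ?_)
  simp only [radialAt, Prod.fst_sub, Prod.snd_sub, sub_zero]
  ring_nf

/-- The point reflection `p ↦ (d, 0) - p` exchanges the two centres. -/
theorem integral_radialAt_mul_radialAt_comm (f g : ℝ → ℝ) (d : ℝ) :
    ∫ p, radialAt 0 f p * radialAt d g p = ∫ p, radialAt 0 g p * radialAt d f p := by
  rw [← integral_sub_left_eq_self (fun p => radialAt 0 g p * radialAt d f p) volume
    ((d, 0) : ℝ × ℝ)]
  refine integral_congr_ae (Eventually.of_forall fun p => ?_)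
  simp only [radialAt, Prod.fst_sub, Prod.snd_sub]
  ring_nf

theorem memLp_radialAt {f : ℝ → ℝ} (hf : Measurable f)
    (hf2 : IntegrableOn (fun r => r * f r ^ 2) (Set.Ioi 0)) (c : ℝ) :
    MemLp (radialAt c f) 2 := by
  have h0 : MemLp (radialAt 0 f) 2 := by
    rw [memLp_two_iff_integrable_sq (measurable_radialAt hf 0).aestronglyMeasurable]
    exact integrable_radialAt_zero (f := fun r => f r ^ 2) hf2
  convert h0.comp_measurePreserving (measurePreserving_sub_right volume ((c, 0) : ℝ × ℝ)) using 1
  ext p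
  simp [radialAt]

theorem integrable_radialAt_mul_radialAt {f g : ℝ → ℝ} {c d : ℝ}
    (hf : MemLp (radialAt c f) 2) (hg : MemLp (radialAt d g) 2) :
    Integrable fun p => radialAt c f p * radialAt d g p :=
  hf.integrable_mul hg

/-! ### Convolution with `K₀`. -/

theorem mul_sqrt_add_sq {Γ : ℝ} (hΓ : 0 < Γ) (X Y : ℝ) :
    Γ * Real.sqrt (X ^ 2 + Y ^ 2) = Real.sqrt ((Γ * X) ^ 2 + (Γ * Y) ^ 2) := by
  rw [mul_pow, mul_pow, ← mul_add, Real.sqrt_mul (sq_nonneg Γ), Real.sqrt_sq hΓ.le]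

theorem integral_besselK_circle_of_lt {Γ r d : ℝ} (hΓ : 0 < Γ) (hr : 0 < r) (hrd : r < d) :
    ∫ θ in Set.Ioo (-Real.pi) Real.pi,
        besselK 0 (Γ * Real.sqrt ((r * Real.cos θ - d) ^ 2 + (r * Real.sin θ) ^ 2)) =
      2 * Real.pi * (besselI 0 (Γ * r) * besselK 0 (Γ * d)) := by
  rw [← integral_besselK_circle (by positivity) (mul_lt_mul_of_pos_left hrd hΓ)]
  simp only [mul_sqrt_add_sq hΓ, mul_sub, mul_assoc]

/-- By the law of cosines the distance is symmetric in `r` and `d`, so the other case applies with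
the radii exchanged. -/
theorem integral_besselK_circle_of_gt {Γ r d : ℝ} (hΓ : 0 < Γ) (hd : 0 < d) (hrd : d < r) :
    ∫ θ in Set.Ioo (-Real.pi) Real.pi,
        besselK 0 (Γ * Real.sqrt ((r * Real.cos θ - d) ^ 2 + (r * Real.sin θ) ^ 2)) =
      2 * Real.pi * (besselI 0 (Γ * d) * besselK 0 (Γ * r)) := by
  rw [← integral_besselK_circle_of_lt hΓ hd hrd]
  refine integral_congr_ae (Eventually.of_forall fun θ => ?_)
  have : (r * Real.cos θ - d) ^ 2 + (r * Real.sin θ) ^ 2 =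
      (d * Real.cos θ - r) ^ 2 + (d * Real.sin θ) ^ 2 := by
    linear_combination (r ^ 2 - d ^ 2) * Real.cos_sq_add_sin_sq θ
  simp only [this]

/-- Convolution of a radial function with `K₀`. -/
theorem integral_radialAt_mul_besselK {f : ℝ → ℝ} {Γ d : ℝ} (hΓ : 0 < Γ) (hd : 0 < d)
    (hf : Integrable fun p => radialAt 0 f p * radialAt d (fun r => besselK 0 (Γ * r)) p) :
    ∫ p, radialAt 0 f p * radialAt d (fun r => besselK 0 (Γ * r)) p =
      2 * Real.pi * (besselK 0 (Γ * d) * (∫ r in Set.Ioc 0 d, r * (f r * besselI 0 (Γ * r))) +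
        besselI 0 (Γ * d) * ∫ r in Set.Ioi d, r * (f r * besselK 0 (Γ * r))) := by
  obtain ⟨hi, h⟩ := integral_eq_integral_polarCoord hf
  have hin : ∀ r, 0 < r → ∫ θ in Set.Ioo (-Real.pi) Real.pi,
      r * (radialAt 0 f (r * Real.cos θ, r * Real.sin θ) *
        radialAt d (fun r => besselK 0 (Γ * r)) (r * Real.cos θ, r * Real.sin θ)) =
      r * f r * ∫ θ in Set.Ioo (-Real.pi) Real.pi,
        besselK 0 (Γ * Real.sqrt ((r * Real.cos θ - d) ^ 2 + (r * Real.sin θ) ^ 2)) :=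
    fun r hr => by
    simp only [radialAt, sqrt_polar hr]
    rw [← integral_const_mul]
    simp only [mul_assoc]
  rw [h, ← Set.Ioc_union_Ioi_eq_Ioi hd.le, setIntegral_union (Set.Ioc_disjoint_Ioi le_rfl)
    measurableSet_Ioi (hi.mono_set Set.Ioc_subset_Ioi_self)
    (hi.mono_set (Set.Ioi_subset_Ioi hd.le)), mul_add]
  congr 1
  · rw [integral_Ioc_eq_integral_Ioo, integral_Ioc_eq_integral_Ioo, ← integral_const_mul,
      ← integral_const_mul]
    refine setIntegral_congr_fun measurableSet_Ioo fun r hr => ?_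
    rw [hin r hr.1, integral_besselK_circle_of_lt hΓ hr.1 hr.2]
    ring
  · rw [← integral_const_mul, ← integral_const_mul]
    refine setIntegral_congr_fun measurableSet_Ioi fun r hr => ?_
    rw [hin r (hd.trans hr), integral_besselK_circle_of_gt hΓ hd hr]
    ring

theorem memLp_radialAt_besselK {Γ : ℝ} (hΓ : 0 < Γ) (c : ℝ) :
    MemLp (radialAt c fun r => besselK 0 (Γ * r)) 2 :=
  memLp_radialAt (measurable_besselK_zero.comp (measurable_const_mul Γ))
    (integrableOn_mul_besselK_sq hΓ) c

/-- `∬ K₀(Γ |p|) K₀(Γ |p - d|) dp = π d K₁(Γ d) / Γ`. -/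
theorem integral_besselK_mul_besselK {Γ d : ℝ} (hΓ : 0 < Γ) (hd : 0 < d) :
    ∫ p, radialAt 0 (fun r => besselK 0 (Γ * r)) p * radialAt d (fun r => besselK 0 (Γ * r)) p =
      Real.pi * d * besselK 1 (Γ * d) / Γ := by
  rw [integral_radialAt_mul_besselK hΓ hd (integrable_radialAt_mul_radialAt
    (memLp_radialAt_besselK hΓ 0) (memLp_radialAt_besselK hΓ d)),
    (integral_mul_besselK_mul_besselI hΓ hd).2]
  have h := integral_mul_besselK_sq hΓ hd
  simp only [pow_two (besselK 0 _)] at h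
  rw [h]
  have hw := mul_besselK_besselI_wronskian (mul_pos hΓ hd)
  rw [eq_div_iff hΓ.ne']
  -- The terms in `I₀ K₀²` from inside and outside radius `d` cancel; what remains is `K₁` times the
  -- Wronskian.
  linear_combination Real.pi * d * besselK 1 (Γ * d) * hw

/-! ### The modes: norm, splitting and overlaps. -/

namespace WaveguideArray

variable {W : WaveguideArray} {β₀ : ℝ}

theorem k_pos (W : WaveguideArray) : 0 < W.k :=
  mul_pos (div_pos (by positivity) W.wavelength_pos) W.n₀_pos

theorem IsGuidedShift.cladΓ_pos (h : W.IsGuidedShift β₀) : 0 < W.cladΓ β₀ :=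
  Real.sqrt_pos.2 (mul_pos (mul_pos two_pos W.k_pos) h.pos)

theorem IsGuidedShift.coreΛ_pos (h : W.IsGuidedShift β₀) : 0 < W.coreΛ β₀ := by
  refine Real.sqrt_pos.2 ?_
  have h1 := mul_lt_mul_of_pos_left h.lt (mul_pos two_pos W.k_pos)
  have h2 : 2 * W.k * (W.k * W.Δn / W.n₀) = 2 * W.k ^ 2 * W.Δn / W.n₀ := by ring
  linarith

theorem mode_eq_radialAt (W : WaveguideArray) (β₀ : ℝ) (m : ℤ) :
    W.mode β₀ m = radialAt (m * W.Dh) (W.profile β₀) := rfl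

theorem profile_of_lt {r : ℝ} (hr : r < W.a) :
    W.profile β₀ r = W.ampA β₀ * besselJ 0 (W.coreΛ β₀ * r) := if_pos hr

theorem profile_of_le {r : ℝ} (hr : W.a ≤ r) :
    W.profile β₀ r = W.ampB β₀ * besselK 0 (W.cladΓ β₀ * r) := if_neg hr.not_gt

theorem measurable_profile (W : WaveguideArray) (β₀ : ℝ) : Measurable (W.profile β₀) :=
  Measurable.ite measurableSet_Iio
    ((continuous_besselJ_zero.measurable.comp (measurable_const_mul _)).const_mul _)
    ((measurable_besselK_zero.comp (measurable_const_mul _)).const_mul _)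

theorem IsGuidedShift.integral_mul_profile_sq (h : W.IsGuidedShift β₀) :
    IntegrableOn (fun r => r * W.profile β₀ r ^ 2) (Set.Ioi 0) ∧
    ∫ r in Set.Ioi (0 : ℝ), r * W.profile β₀ r ^ 2 =
      W.ampA β₀ ^ 2 * (W.a ^ 2 / 2 * (besselJ 1 (W.coreΛ β₀ * W.a) ^ 2 +
        besselJ 0 (W.coreΛ β₀ * W.a) ^ 2)) +
      W.ampB β₀ ^ 2 * (W.a ^ 2 / 2 * (besselK 1 (W.cladΓ β₀ * W.a) ^ 2 -
        besselK 0 (W.cladΓ β₀ * W.a) ^ 2)) := by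
  have ha := W.a_pos
  have hJ := continuous_besselJ_zero
  have hcore : Set.EqOn (fun r => W.ampA β₀ ^ 2 * (r * besselJ 0 (W.coreΛ β₀ * r) ^ 2))
      (fun r => r * W.profile β₀ r ^ 2) (Set.Ioo 0 W.a) := fun r hr => by
    simp only [profile_of_lt hr.2]
    ring
  have hclad : Set.EqOn (fun r => W.ampB β₀ ^ 2 * (r * besselK 0 (W.cladΓ β₀ * r) ^ 2))
      (fun r => r * W.profile β₀ r ^ 2) (Set.Ici W.a) := fun r hr => by
    simp only [profile_of_le hr]
    ring
  have hi1 : IntegrableOn (fun r => r * W.profile β₀ r ^ 2) (Set.Ioo 0 W.a) := by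
    refine IntegrableOn.congr_fun ?_ hcore measurableSet_Ioo
    exact (Continuous.integrableOn_Icc (by fun_prop)).mono_set Set.Ioo_subset_Icc_self
  have hi2 : IntegrableOn (fun r => r * W.profile β₀ r ^ 2) (Set.Ici W.a) := by
    refine IntegrableOn.congr_fun ?_ hclad measurableSet_Ici
    exact ((integrableOn_mul_besselK_sq h.cladΓ_pos).mono_set
      fun r hr => ha.trans_le hr).const_mul _
  rw [← Set.Ioo_union_Ici_eq_Ioi ha]
  refine ⟨hi1.union hi2, ?_⟩
  rw [setIntegral_union (Set.disjoint_left.2 fun r h1 h2 => (h1.2.trans_le h2).false)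
    measurableSet_Ici hi1 hi2, ← setIntegral_congr_fun measurableSet_Ioo hcore,
    ← setIntegral_congr_fun measurableSet_Ici hclad, integral_const_mul, integral_const_mul,
    ← integral_Ioc_eq_integral_Ioo, integral_mul_besselJ_sq h.coreΛ_pos ha,
    integral_Ici_eq_integral_Ioi, integral_mul_besselK_sq h.cladΓ_pos ha]

theorem IsGuidedShift.memLp_mode (h : W.IsGuidedShift β₀) (c : ℝ) :
    MemLp (radialAt c (W.profile β₀)) 2 :=
  memLp_radialAt (W.measurable_profile β₀) h.integral_mul_profile_sq.1 c

theorem IsGuidedShift.overlap_self (h : W.IsGuidedShift β₀) (i : ℤ) : W.overlap β₀ i i = 1 := by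
  rw [overlap]
  simp only [mode_eq_radialAt]
  rw [integral_radialAt_mul_radialAt_translate, sub_self]
  have h1 := integral_radialAt_zero h.integral_mul_profile_sq.1
  simp only [radialAt, ← pow_two] at h1 ⊢
  rw [h1, h.integral_mul_profile_sq.2]
  have ha := W.a_pos
  have hK : besselK 0 (W.cladΓ β₀ * W.a) ^ 2 ≤ besselK 1 (W.cladΓ β₀ * W.a) ^ 2 :=
    pow_le_pow_left₀ (besselK_zero_nonneg _) (besselK_zero_le_one (mul_pos h.cladΓ_pos ha)) 2
  have hJ := h.J_ne_zero
  set N : ℝ := Real.pi * W.a ^ 2 *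
      (besselJ 1 (W.coreΛ β₀ * W.a) ^ 2 + besselJ 0 (W.coreΛ β₀ * W.a) ^ 2) +
    Real.pi * W.a ^ 2 * (besselJ 0 (W.coreΛ β₀ * W.a) / besselK 0 (W.cladΓ β₀ * W.a)) ^ 2 *
      (besselK 1 (W.cladΓ β₀ * W.a) ^ 2 - besselK 0 (W.cladΓ β₀ * W.a) ^ 2) with hN
  -- Strict positivity comes from `J₀(Λ a) ≠ 0` in the core term; the cladding term is nonnegative
  -- because `K₀ ≤ K₁`.
  have hNpos : 0 < N := by
    refine add_pos_of_pos_of_nonneg (by positivity) (mul_nonneg (by positivity) (by linarith))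
  have hA : W.ampA β₀ ^ 2 = N⁻¹ := by
    rw [ampA, ← hN, ← Real.rpow_natCast, ← Real.rpow_mul hNpos.le, ← Real.rpow_neg_one]
    norm_num
  rw [ampB, mul_pow, hA]
  rw [← inv_mul_cancel₀ hNpos.ne']
  conv_rhs => rw [hN]
  ring

noncomputable section

/-- The profile minus the continuation of its cladding part into the core. -/
def coreExcess (W : WaveguideArray) (β₀ r : ℝ) : ℝ :=
  W.profile β₀ r - W.ampB β₀ * besselK 0 (W.cladΓ β₀ * r)

end

theorem coreExcess_of_le {r : ℝ} (hr : W.a ≤ r) : W.coreExcess β₀ r = 0 := by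
  rw [coreExcess, profile_of_le hr, sub_self]

theorem coreExcess_of_lt {r : ℝ} (hr : r < W.a) : W.coreExcess β₀ r =
    W.ampA β₀ * besselJ 0 (W.coreΛ β₀ * r) - W.ampB β₀ * besselK 0 (W.cladΓ β₀ * r) := by
  rw [coreExcess, profile_of_lt hr]

theorem IsGuidedShift.memLp_coreExcess (h : W.IsGuidedShift β₀) (c : ℝ) :
    MemLp (radialAt c (W.coreExcess β₀)) 2 :=
  (h.memLp_mode c).sub ((memLp_radialAt_besselK h.cladΓ_pos c).const_mul (W.ampB β₀))

/-- Cores whose centres are at least `2 a` apart do not overlap. -/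
theorem coreExcess_mul_coreExcess {d : ℝ} (hd : 2 * W.a ≤ d) (p : ℝ × ℝ) :
    radialAt 0 (W.coreExcess β₀) p * radialAt d (W.coreExcess β₀) p = 0 := by
  by_contra hne
  have h0 : Real.sqrt ((p.1 - 0) ^ 2 + p.2 ^ 2) < W.a :=
    lt_of_not_ge fun h => hne (by rw [radialAt, coreExcess_of_le h, zero_mul])
  have h1 : Real.sqrt ((p.1 - d) ^ 2 + p.2 ^ 2) < W.a :=
    lt_of_not_ge fun h => hne (by rw [radialAt, radialAt, coreExcess_of_le h, mul_zero])
  have h2 : |p.1 - 0| < W.a :=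
    (Real.abs_le_sqrt (by linarith [sq_nonneg p.2])).trans_lt h0
  have h3 : |p.1 - d| < W.a :=
    (Real.abs_le_sqrt (by linarith [sq_nonneg p.2])).trans_lt h1
  linarith [(abs_lt.1 h2).2, (abs_lt.1 h3).1]

theorem IsGuidedShift.integral_coreExcess_mul_besselK (h : W.IsGuidedShift β₀) {d : ℝ}
    (hd : 2 * W.a ≤ d) :
    ∫ p, radialAt 0 (W.coreExcess β₀) p * radialAt d (fun r => besselK 0 (W.cladΓ β₀ * r)) p =
      2 * Real.pi * besselK 0 (W.cladΓ β₀ * d) *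
        (W.ampA β₀ * (W.a / (W.cladΓ β₀ ^ 2 + W.coreΛ β₀ ^ 2) *
          (W.coreΛ β₀ * besselI 0 (W.cladΓ β₀ * W.a) * besselJ 1 (W.coreΛ β₀ * W.a) +
          W.cladΓ β₀ * besselJ 0 (W.coreΛ β₀ * W.a) * besselI 1 (W.cladΓ β₀ * W.a))) -
        W.ampB β₀ * (W.a ^ 2 / 2 *
          (besselI 0 (W.cladΓ β₀ * W.a) * besselK 0 (W.cladΓ β₀ * W.a) +
          besselI 1 (W.cladΓ β₀ * W.a) * besselK 1 (W.cladΓ β₀ * W.a)))) := by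
  have ha := W.a_pos
  have hd0 : 0 < d := by linarith
  have hJ := continuous_besselJ_zero
  have hI := continuous_besselI_zero
  rw [integral_radialAt_mul_besselK h.cladΓ_pos hd0 (integrable_radialAt_mul_radialAt
    (h.memLp_coreExcess 0) (memLp_radialAt_besselK h.cladΓ_pos d))]
  -- Since `a < d`, the core lies within radius `d` and only the inner branch of the circular mean
  -- contributes.
  have hout : ∫ r in Set.Ioi d, r * (W.coreExcess β₀ r * besselK 0 (W.cladΓ β₀ * r)) = 0 := by
    refine setIntegral_eq_zero_of_forall_eq_zero fun r hr => ?_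
    rw [Set.mem_Ioi] at hr
    rw [coreExcess_of_le (by linarith), zero_mul, mul_zero]
  have hin : ∫ r in Set.Ioc 0 d, r * (W.coreExcess β₀ r * besselI 0 (W.cladΓ β₀ * r)) =
      ∫ r in Set.Ioo 0 W.a, (W.ampA β₀ *
        (r * (besselJ 0 (W.coreΛ β₀ * r) * besselI 0 (W.cladΓ β₀ * r))) -
        W.ampB β₀ * (r * (besselK 0 (W.cladΓ β₀ * r) * besselI 0 (W.cladΓ β₀ * r)))) := by
    refine (setIntegral_eq_of_subset_of_forall_sdiff_eq_zero measurableSet_Ioc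
      (s := Set.Ioo 0 W.a) (fun r hr => ⟨hr.1, by linarith [hr.2]⟩) fun r hr => ?_).trans
      (setIntegral_congr_fun measurableSet_Ioo fun r hr => ?_)
    · rw [coreExcess_of_le (not_lt.1 fun hlt => hr.2 ⟨hr.1.1, hlt⟩), zero_mul, mul_zero]
    · simp only [coreExcess_of_lt hr.2]
      ring
  obtain ⟨hi, hK⟩ := integral_mul_besselK_mul_besselI h.cladΓ_pos ha
  rw [hout, hin, ← integral_Ioc_eq_integral_Ioo, integral_sub, integral_const_mul,
    integral_const_mul, hK, integral_mul_besselJ_mul_besselI h.coreΛ_pos h.cladΓ_pos ha]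
  · ring
  · exact (Continuous.integrableOn_Icc (by fun_prop)).mono_set Set.Ioc_subset_Icc_self
  · exact hi.const_mul _

theorem IsGuidedShift.integral_profile_mul_profile (h : W.IsGuidedShift β₀) {d : ℝ}
    (hd : 2 * W.a ≤ d) :
    ∫ p, radialAt 0 (W.profile β₀) p * radialAt d (W.profile β₀) p =
      W.ampB β₀ ^ 2 * (Real.pi * d * besselK 1 (W.cladΓ β₀ * d) / W.cladΓ β₀) +
      2 * W.ampB β₀ * ∫ p, radialAt 0 (W.coreExcess β₀) p *
        radialAt d (fun r => besselK 0 (W.cladΓ β₀ * r)) p := by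
  have hd0 : 0 < d := by linarith [W.a_pos]
  have hK := memLp_radialAt_besselK h.cladΓ_pos
  have hE := h.memLp_coreExcess
  -- Expanding both factors as cladding continuation plus excess gives four terms; the excess-excess
  -- term vanishes pointwise.
  have hsplit : ∀ p, radialAt 0 (W.profile β₀) p * radialAt d (W.profile β₀) p =
      W.ampB β₀ ^ 2 * (radialAt 0 (fun r => besselK 0 (W.cladΓ β₀ * r)) p *
        radialAt d (fun r => besselK 0 (W.cladΓ β₀ * r)) p) +
      (W.ampB β₀ * (radialAt 0 (W.coreExcess β₀) p *
        radialAt d (fun r => besselK 0 (W.cladΓ β₀ * r)) p) +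
      W.ampB β₀ * (radialAt 0 (fun r => besselK 0 (W.cladΓ β₀ * r)) p *
        radialAt d (W.coreExcess β₀) p)) := fun p => by
    have h1 := coreExcess_mul_coreExcess (β₀ := β₀) hd p
    simp only [radialAt, coreExcess] at h1 ⊢
    linear_combination h1
  have hi1 := integrable_radialAt_mul_radialAt (hK 0) (hK d)
  have hi2 := integrable_radialAt_mul_radialAt (hE 0) (hK d)
  have hi3 := integrable_radialAt_mul_radialAt (hK 0) (hE d)
  simp only [hsplit]
  rw [integral_add (hi1.const_mul _) (by exact (hi2.const_mul _).add (hi3.const_mul _)),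
    integral_add (hi2.const_mul _) (hi3.const_mul _), integral_const_mul, integral_const_mul,
    integral_const_mul, integral_besselK_mul_besselK h.cladΓ_pos hd0,
    integral_radialAt_mul_radialAt_comm (fun r => besselK 0 (W.cladΓ β₀ * r))]
  ring

theorem overlap_comm (W : WaveguideArray) (β₀ : ℝ) (i j : ℤ) :
    W.overlap β₀ i j = W.overlap β₀ j i := by
  simp only [overlap, mul_comm]

theorem overlap_eq_integral (W : WaveguideArray) (β₀ : ℝ) {i j : ℤ} {ξ : ℕ}
    (hij : |i - j| = (ξ : ℤ)) :
    W.overlap β₀ i j =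
      ∫ p, radialAt 0 (W.profile β₀) p * radialAt (ξ * W.Dh) (W.profile β₀) p := by
  wlog hle : i ≤ j generalizing i j
  · rw [overlap_comm]
    exact this (by rwa [abs_sub_comm]) (le_of_not_ge hle)
  have h1 : j - i = (ξ : ℤ) := by rw [← hij, abs_sub_comm, abs_of_nonneg (by linarith)]
  rw [overlap]
  simp only [mode_eq_radialAt]
  rw [integral_radialAt_mul_radialAt_translate, ← sub_mul, ← Int.cast_sub, h1, Int.cast_natCast]

end WaveguideArray

theorem mainTheorem4 (W : WaveguideArray) (β₀ : ℝ) (hβ₀ : W.IsGuidedShift β₀)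
    (a Λ Γ A B : ℝ) (ha : a = W.a) (hΛ : Λ = W.coreΛ β₀) (hΓ : Γ = W.cladΓ β₀)
    (hA : A = W.ampA β₀) (hB : B = W.ampB β₀) :
    (∀ i j : ℤ, Integrable (fun p : ℝ × ℝ => W.mode β₀ i p * W.mode β₀ j p)) ∧
    (∀ i : ℤ, W.overlap β₀ i i = 1) ∧
    (∀ (i j : ℤ) (ξ : ℕ) (d : ℝ), 0 < ξ → |i - j| = (ξ : ℤ) → d = ξ * W.Dh → 2 * a ≤ d →
      W.overlap β₀ i j =
        4 * a * Real.pi * A * B * besselK 0 (Γ * d) / (Γ ^ 2 + Λ ^ 2) *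
            (Λ * besselI 0 (Γ * a) * besselJ 1 (Λ * a) +
              Γ * besselJ 0 (Λ * a) * besselI 1 (Γ * a)) +
          Real.pi * B ^ 2 * d * besselK 1 (Γ * d) / Γ -
          2 * Real.pi * B ^ 2 * a ^ 2 * besselK 0 (Γ * d) *
            (besselI 0 (Γ * a) * besselK 0 (Γ * a) +
              besselI 1 (Γ * a) * besselK 1 (Γ * a))) := by
  subst ha hΛ hΓ hA hB
  refine ⟨fun i j => ?_, hβ₀.overlap_self, fun i j ξ d _ hij hd had => ?_⟩
  · exact integrable_radialAt_mul_radialAt (hβ₀.memLp_mode _) (hβ₀.memLp_mode _)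
  · rw [W.overlap_eq_integral β₀ hij, ← hd, hβ₀.integral_profile_mul_profile had,
      hβ₀.integral_coreExcess_mul_besselK had]
    ring
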